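/- For a field $k$, let $\mathrm{SAut}_k(\mathbb A^2)$ be the group (under composition) of polynomial automorphisms of $\mathbb A^2$ over $k$ with Jacobian determinant $1$, let $\mathrm{SL}_2(k)\subseteq \mathrm{SAut}_k(\mathbb A^2)$ be the subgroup of linear automorphisms of determinant $1$, and let $\mathrm{SAff}_k(\mathbb A^2)$ be the subgroup of those elements of $\mathrm{SAut}_k(\mathbb A^2)$ that are compositions of a translation with an invertible linear map. Let $V\subseteq k[x]$ be the $k$-linear subspace generated by $\{s(x)-a\,s(ax+b)\mid s\in k[x],\ a\in k^*,\ b\in k\}$. (A) Let $k$ be any field. 1. $k\subseteq V$. 2. If $k$ is infinite, then $V=k[x]$. 3. If $k$ is finite with $q$ elements, the classes in $k[x]/V$ of the polynomials $x^{q-1}(x^q-x)^{m(q-1)-1}$, $m\ge 1$, are linearly independent over $k$; in particular $k[x]/V$ is infinite-dimensional. 4. If $|k|>2$, then $cx+d\in V$ for all $c,d\in k$. 5. If $|k|=2$, then $V=k[x(x+1)]$, so $x\notin V$. (B) Let $k$ be a finite field. 1. There is a unique group homomorphism $\rho\colon \mathrm{SAut}_k(\mathbb A^2)\to k[x]/V$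 that sends $(x_1,x_2+s(x_1))$ to the class of $s$ for each $s\in k[x]$. It is surjective, its kernel contains all translations, and its kernel contains $\mathrm{SL}_2(k)$ if and only if $|k|>2$. 2. There is a surjective group homomorphism $\tau\colon\mathrm{SAut}_k(\mathbb A^2)\to (k[x],+)$, of the form $\tau=L\circ\rho$ with $L\colon k[x]/V\to k[x]$ a $k$-linear map, whose kernel contains all translations and all elements of $\mathrm{SL}_2(k)$. 3. The group $\mathrm{SAut}_k(\mathbb A^2)$ is not perfect and not finitely generated, and the normal subgroup of $\mathrm{SAut}_k(\mathbb A^2)$ generated by $\mathrm{SAff}_k(\mathbb A^2)$ is a proper subgroup. 4. If $|k|=2$, that is $k=\mathbb F_2$, there is also a surjective group homomorphism $\mathrm{SAut}_k(\mathbb A^2)\to (k[x],+)$, of the form $L\circ\rho$ with $L\colon k[x]/V\to k[x]$ a $k$-linear map, whose kernel contains all translations but does not contain $\mathrm{SL}_2(k)$. -/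

import Mathlib

open MvPolynomial

/-- An `R`-endomorphism `f = (f_1, …, f_n)` of the affine space `𝔸ⁿ`: an `n`-tuple of polynomials
in `n` variables. -/
@[ext]
structure AffineEnd (n : ℕ) (R : Type*) [CommRing R] where
  coord : Fin n → MvPolynomial (Fin n) R

namespace AffineEnd

variable {n : ℕ} {R : Type*} [CommRing R]

/-- Composition: the `i`-th coordinate of `f ∘ g` is `f_i(g_1, …, g_n)`. -/
noncomputable instance : Mul (AffineEnd n R) where
  mul f g := ⟨fun i => bind₁ g.coord (f.coord i)⟩

/-- The identity `(x_1, …, x_n)`. -/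
noncomputable instance : One (AffineEnd n R) where
  one := ⟨fun i => X i⟩

theorem mul_coord (f g : AffineEnd n R) (i : Fin n) :
    (f * g).coord i = bind₁ g.coord (f.coord i) := rfl

theorem one_coord (i : Fin n) : (1 : AffineEnd n R).coord i = X i := rfl

noncomputable instance : Monoid (AffineEnd n R) where
  mul_assoc f g h := AffineEnd.ext (funext fun i => by
    simp only [mul_coord]
    rw [bind₁_bind₁]
    rfl)
  one_mul f := AffineEnd.ext (funext fun i => by
    rw [mul_coord, one_coord, bind₁_X_right])
  mul_one f := AffineEnd.ext (funext fun i => by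
    rw [mul_coord]
    change bind₁ X (f.coord i) = f.coord i
    rw [bind₁_X_left, AlgHom.id_apply])

/-- The derivative `Df = (∂f_i/∂x_j)_{i,j}`. -/
noncomputable def derivative (f : AffineEnd n R) :
    Matrix (Fin n) (Fin n) (MvPolynomial (Fin n) R) :=
  Matrix.of fun i j => pderiv j (f.coord i)

/-- The Jacobian `Jac(f) = det(Df)`. -/
noncomputable def jac (f : AffineEnd n R) : MvPolynomial (Fin n) R :=
  f.derivative.det

theorem pderiv_bind₁ (g : Fin n → MvPolynomial (Fin n) R) (j : Fin n)
    (p : MvPolynomial (Fin n) R) :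
    pderiv j (bind₁ g p) = ∑ l, bind₁ g (pderiv l p) * pderiv j (g l) := by
  induction p using MvPolynomial.induction_on with
  | C a => simp
  | add p q hp hq => simp [hp, hq, add_mul, Finset.sum_add_distrib]
  | mul_X p i hp =>
    simp only [map_mul, bind₁_X_right, Derivation.leibniz, smul_eq_mul, hp, map_add, pderiv_X,
      add_mul, Finset.sum_add_distrib, Finset.mul_sum]
    congr 1
    · rw [Finset.sum_eq_single i]
      · simp
      · intro l _ hl
        simp [hl.symm]
      · simp
    · exact Finset.sum_congr rfl fun l _ => by ring

theorem derivative_mul (f g : AffineEnd n R) :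
    (f * g).derivative = (bind₁ g.coord).mapMatrix f.derivative * g.derivative := by
  ext1 i j
  simp only [derivative, Matrix.of_apply, mul_coord, pderiv_bind₁, Matrix.mul_apply,
    AlgHom.mapMatrix_apply, Matrix.map_apply]

theorem jac_mul (f g : AffineEnd n R) : (f * g).jac = bind₁ g.coord f.jac * g.jac := by
  rw [jac, derivative_mul, Matrix.det_mul, ← AlgHom.map_det]
  rfl

theorem jac_one : (1 : AffineEnd n R).jac = 1 := by
  have h : (1 : AffineEnd n R).derivative = 1 := by
    ext1 i j
    simp [derivative, one_coord, pderiv_X, Matrix.one_apply, Pi.single_apply]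
  rw [jac, h, Matrix.det_one]

end AffineEnd

/-- `Aut_R(𝔸ⁿ)`: the group of invertible elements of `End_R(𝔸ⁿ)` under composition. -/
abbrev AffineAut (n : ℕ) (R : Type*) [CommRing R] : Type _ := (AffineEnd n R)ˣ

/-- `SAut_R(𝔸ⁿ)`: the subgroup of automorphisms of Jacobian `1`. -/
noncomputable def SAut (n : ℕ) (R : Type*) [CommRing R] : Subgroup (AffineAut n R) where
  carrier := {f | f.val.jac = 1}
  one_mem' := AffineEnd.jac_one
  mul_mem' {f g} hf hg := by
    change (f.val * g.val).jac = 1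
    rw [AffineEnd.jac_mul, show f.val.jac = 1 from hf, show g.val.jac = 1 from hg]
    simp
  inv_mem' {f} hf := by
    change (f⁻¹).val.jac = 1
    have h := AffineEnd.jac_mul f.val (f⁻¹).val
    rw [Units.mul_inv, AffineEnd.jac_one, show f.val.jac = 1 from hf] at h
    simpa using h.symm

section Elements

variable {n : ℕ} {R : Type*} [CommRing R]

/-- The translation `(x_1 + v_1, …, x_n + v_n)`. -/
noncomputable def translationAut (v : Fin n → R) : AffineAut n R where
  val := ⟨fun i => X i + C (v i)⟩
  inv := ⟨fun i => X i + C (-v i)⟩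
  val_inv := AffineEnd.ext (funext fun i => by
    simp [AffineEnd.mul_coord, AffineEnd.one_coord])
  inv_val := AffineEnd.ext (funext fun i => by
    simp [AffineEnd.mul_coord, AffineEnd.one_coord])

/-- The linear endomorphism `(∑_j a_{1j} x_j, …, ∑_j a_{nj} x_j)`. -/
noncomputable def linearEnd (M : Matrix (Fin n) (Fin n) R) : AffineEnd n R :=
  ⟨fun i => ∑ j, C (M i j) * X j⟩

theorem linearEnd_mul (M N : Matrix (Fin n) (Fin n) R) :
    linearEnd (M * N) = linearEnd M * linearEnd N := by
  refine AffineEnd.ext (funext fun i => ?_)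
  simp only [AffineEnd.mul_coord, linearEnd, Matrix.mul_apply, map_sum, map_mul, bind₁_C_right,
    bind₁_X_right, Finset.mul_sum, Finset.sum_mul]
  rw [Finset.sum_comm]
  exact Finset.sum_congr rfl fun _ _ => Finset.sum_congr rfl fun _ _ => by ring

theorem linearEnd_one : linearEnd (1 : Matrix (Fin n) (Fin n) R) = 1 := by
  refine AffineEnd.ext (funext fun i => ?_)
  change ∑ j, C ((1 : Matrix (Fin n) (Fin n) R) i j) * X j = X i
  simp [Matrix.one_apply, apply_ite]

/-- The linear automorphism given by an invertible matrix. -/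
noncomputable def linearAut (M : Matrix.GeneralLinearGroup (Fin n) R) : AffineAut n R where
  val := linearEnd M.val
  inv := linearEnd (M⁻¹).val
  val_inv := by rw [← linearEnd_mul, Units.mul_inv, linearEnd_one]
  inv_val := by rw [← linearEnd_mul, Units.inv_mul, linearEnd_one]

/-- For `s ∈ R[x]`, the automorphism `(x_1, x_2 + s(x_1))` of `𝔸²`. -/
noncomputable def shearAut (s : Polynomial R) : AffineAut 2 R where
  val := ⟨![X 0, X 1 + Polynomial.aeval (X 0) s]⟩
  inv := ⟨![X 0, X 1 - Polynomial.aeval (X 0) s]⟩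
  val_inv := AffineEnd.ext (funext fun i => by
    fin_cases i <;> simp [AffineEnd.mul_coord, AffineEnd.one_coord, ← Polynomial.aeval_algHom_apply])
  inv_val := AffineEnd.ext (funext fun i => by
    fin_cases i <;> simp [AffineEnd.mul_coord, AffineEnd.one_coord, ← Polynomial.aeval_algHom_apply])

theorem shearAut_mem (s : Polynomial R) : shearAut s ∈ SAut 2 R := by
  change (shearAut s).val.jac = 1
  have h : pderiv (1 : Fin 2) (Polynomial.aeval (X 0 : MvPolynomial (Fin 2) R) s) = 0 := by
    rw [Derivation.map_aeval]
    simp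
  simp [AffineEnd.jac, AffineEnd.derivative, shearAut, Matrix.det_fin_two, h, pderiv_X]

/-- `(x_1, x_2 + s(x_1))` as an element of `SAut_R(𝔸²)`. -/
noncomputable def shear (s : Polynomial R) : SAut 2 R := ⟨shearAut s, shearAut_mem s⟩

end Elements

section Subsets

variable (n : ℕ) (R : Type*) [CommRing R]

/-- The translations, as elements of `SAut_R(𝔸ⁿ)`. -/
def translationSet : Set (SAut n R) :=
  {f | ∃ v : Fin n → R, f.val = translationAut v}

/-- `SL_n(R)`, as a set of elements of `SAut_R(𝔸ⁿ)`. -/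
def slSet : Set (SAut n R) :=
  {f | ∃ M : Matrix.GeneralLinearGroup (Fin n) R, M.val.det = 1 ∧ f.val = linearAut M}

/-- `SAff_R(𝔸ⁿ)`: the elements of `SAut_R(𝔸ⁿ)` of the form `τ ∘ α`, with `τ` a translation and
`α ∈ GL_n(R)`. -/
def saffSet : Set (SAut n R) :=
  {f | ∃ (v : Fin n → R) (M : Matrix.GeneralLinearGroup (Fin n) R),
    f.val = translationAut v * linearAut M}

end Subsets

/-- The linear subspace `V ⊆ k[x]` generated by `s(x) - a s(ax + b)`, with `s ∈ k[x]`, `a ∈ k*`,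
`b ∈ k`. -/
noncomputable def spaceV (k : Type*) [Field k] : Submodule k (Polynomial k) :=
  Submodule.span k {p | ∃ (s : Polynomial k) (a b : k), a ≠ 0 ∧
    p = s - Polynomial.C a * s.comp (Polynomial.C a * Polynomial.X + Polynomial.C b)}

/-! The group is the amalgamated product of its affine subgroup and the triangular subgroup of maps
`(a x₁ + b, a⁻¹ x₂ + s(x₁))` along their intersection (`SAut.exists_monoidHom`), so `ρ` may be
prescribed on the two factors. On triangular maps it is the class of `a s`; `V` is exactly what
makes this multiplicative. On affine maps it is trivial if `|k| > 2`, because then all linear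
polynomials lie in `V`; if `|k| = 2` it is the sign of `SL₂(𝔽₂) ≅ S₃` times the class of `x`.
Uniqueness holds because shears and their conjugates by one Weyl element generate the group.

The quotient `k[x]/V` is large because the trace `s ↦ ∑ a s(ax + b)` over the finite affine group
kills `V` and sends the given polynomials to distinct powers of `x^q - x`. Linear maps out of the
quotient then give the surjections `τ`; non-finite generation, non-perfectness and the proper normal
closure follow.

Generation (Jung–van der Kulk) is proved over every field by valuations. Let `f` be an automorphism
with inverse `P`, neither of whose components loses degree on subtracting `c` times a power of the
other. Minus the degree is a valuation `v`, and with respect to logarithmic derivations the volume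
form has value `-2`. A toric change of coordinates adapted to the degrees of `f 0` and `f 1`,
followed by point blow-ups, shows that any `P(f 0, f 1)` has value at most `-2` or at most the
weight of each of its monomials (`IsLogValuation.aeval_le_of_forall_not_lt`). Since `P i (f) = X i`
has value `-1`, both degrees must be `1`. The absence of further relations is a degree count along
reduced words (`SAut.fromAmalgam_injective`). -/

/-! ### Jacobian bracket of two derivations -/

section Bracket

variable {k L : Type*} [Field k] [Field L] [Algebra k L]

/-- The bracket `D₁(p) D₂(q) - D₂(p) D₁(q)` of two derivations. -/
def derivBracket (D₁ D₂ : Derivation k L L) (p q : L) : L := D₁ p * D₂ q - D₂ p * D₁ q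

theorem Derivation.apply_aeval_mvPolynomial (D : Derivation k L L) (g : Fin 2 → L)
    (p : MvPolynomial (Fin 2) k) :
    D (aeval g p) = ∑ i, aeval g (pderiv i p) * D (g i) := by
  induction p using MvPolynomial.induction_on with
  | C a => simp [← algebraMap_eq]
  | add p q hp hq => simp only [map_add, hp, hq, add_mul, Finset.sum_add_distrib]
  | mul_X p i hp =>
    simp only [map_mul, aeval_X, Derivation.leibniz, smul_eq_mul, hp, map_add, pderiv_X,
      add_mul, Finset.sum_add_distrib, Finset.mul_sum]
    congr 1
    · rw [Finset.sum_eq_single i]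
      · simp
      · intro l _ hl
        simp [hl.symm]
      · simp
    · exact Finset.sum_congr rfl fun l _ => by ring

theorem derivBracket_aeval (D₁ D₂ : Derivation k L L) (g : Fin 2 → L)
    (p q : MvPolynomial (Fin 2) k) :
    derivBracket D₁ D₂ (aeval g p) (aeval g q) =
      aeval g (pderiv 0 p * pderiv 1 q - pderiv 1 p * pderiv 0 q) *
        derivBracket D₁ D₂ (g 0) (g 1) := by
  simp only [derivBracket, Derivation.apply_aeval_mvPolynomial, Fin.sum_univ_two, map_sub, map_mul]
  ring

theorem derivBracket_swap (D₁ D₂ : Derivation k L L) (p q : L) :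
    derivBracket D₁ D₂ p q = - derivBracket D₁ D₂ q p := by
  unfold derivBracket; ring

/-- The Jacobian of the blow-up chart `y = x z`: one factor `x` splits off the volume form. -/
theorem derivBracket_mul_right_self (D₁ D₂ : Derivation k L L) (p q : L) :
    derivBracket D₁ D₂ p (p * q) = p * derivBracket D₁ D₂ p q := by
  simp only [derivBracket, Derivation.leibniz, smul_eq_mul]; ring

theorem derivBracket_sub_algebraMap (D₁ D₂ : Derivation k L L) (p q : L) (c : k) :
    derivBracket D₁ D₂ p (q - algebraMap k L c) = derivBracket D₁ D₂ p q := by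
  simp [derivBracket]

theorem derivBracket_inv_left (D₁ D₂ : Derivation k L L) (p q : L) :
    derivBracket D₁ D₂ p⁻¹ q = - (p⁻¹ ^ 2 * derivBracket D₁ D₂ p q) := by
  simp only [derivBracket, Derivation.leibniz_inv, smul_eq_mul]; ring

/-- A unimodular monomial change of coordinates, in logarithmic form. -/
theorem derivBracket_monomials (D₁ D₂ : Derivation k L L) (s u : L) (a b c d : ℕ)
    (h : a * d = b * c + 1) :
    s * u * derivBracket D₁ D₂ (s ^ a * u ^ b) (s ^ c * u ^ d) =
      (s ^ a * u ^ b) * (s ^ c * u ^ d) * derivBracket D₁ D₂ s u := by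
  have hp (D : Derivation k L L) (x : L) (n : ℕ) : x * D (x ^ n) = n * x ^ n * D x := by
    rw [Derivation.leibniz_pow]
    rcases n with _ | n
    · simp
    · simp [pow_succ]; ring
  have hm (D : Derivation k L L) (m n : ℕ) :
      s * u * D (s ^ m * u ^ n) = s ^ m * u ^ n * (m * u * D s + n * s * D u) := by
    rw [Derivation.leibniz, smul_eq_mul, smul_eq_mul]
    linear_combination s * s ^ m * hp D u n + u * u ^ n * hp D s m
  have h' : (a : L) * d = b * c + 1 := by exact_mod_cast congrArg (Nat.cast (R := L)) h
  rcases eq_or_ne (s * u) 0 with h0 | h0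
  · rw [h0, zero_mul]
    have ha : a ≠ 0 := by rintro rfl; omega
    have hd : d ≠ 0 := by rintro rfl; omega
    rcases mul_eq_zero.1 h0 with rfl | rfl
    · simp [ha]
    · simp [hd]
  · apply mul_left_cancel₀ h0
    have e : ∀ m n m' n' : ℕ, s * u * (s * u * derivBracket D₁ D₂ (s ^ m * u ^ n) (s ^ m' * u ^ n')) =
        (s * u * D₁ (s ^ m * u ^ n)) * (s * u * D₂ (s ^ m' * u ^ n')) -
        (s * u * D₂ (s ^ m * u ^ n)) * (s * u * D₁ (s ^ m' * u ^ n')) := by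
      intros; unfold derivBracket; ring
    rw [e, hm, hm, hm, hm]
    unfold derivBracket
    linear_combination (s ^ a * u ^ b * (s ^ c * u ^ d) * (s * u) * (D₁ s * D₂ u - D₂ s * D₁ u)) * h'

end Bracket

/-! ### Evaluation of polynomials in two variables -/

section Substitution

variable {k : Type*} [Field k]

theorem MvPolynomial.aeval_fin_two_eq_sum {A : Type*} [CommRing A] [Algebra k A] (x y : A)
    (p : MvPolynomial (Fin 2) k) :
    aeval ![x, y] p = ∑ m ∈ p.support, algebraMap k A (coeff m p) * (x ^ m 0 * y ^ m 1) := by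
  rw [aeval_def, eval₂_eq']
  simp [Fin.prod_univ_two]

/-- Restriction to the exceptional line keeps the monomials free of `X 0`. This exhibits a monomial
of small degree after a blow-up and so bounds the multiplicity there. -/
theorem MvPolynomial.coeff_aeval_zero_X (p : MvPolynomial (Fin 2) k) (j : ℕ) :
    (aeval ![0, Polynomial.X] p : Polynomial k).coeff j = coeff (Finsupp.single 1 j) p := by
  induction p using MvPolynomial.induction_on' with
  | monomial m c =>
    rw [aeval_monomial, Finsupp.prod_fintype _ _ (by simp)]
    simp only [Fin.prod_univ_two, Matrix.cons_val_zero, Matrix.cons_val_one, coeff_monomial]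
    rw [← Polynomial.C_eq_algebraMap, Polynomial.coeff_C_mul]
    by_cases h0 : m 0 = 0
    · rw [h0, pow_zero, one_mul, Polynomial.coeff_X_pow]
      have : (m = Finsupp.single 1 j) ↔ j = m 1 := by
        constructor
        · rintro rfl; simp
        · rintro rfl; ext i; fin_cases i <;> simp [h0]
      simp [this]
    · rw [zero_pow h0, zero_mul, Polynomial.coeff_zero, mul_zero, if_neg]
      rintro rfl
      simp at h0
  | add p q hp hq => simp [hp, hq]

end Substitution

/-! ### Logarithmic valuations and point blow-ups -/

section Valuation

variable {k L : Type*} [Field k] [Field L] [Algebra k L] (v : AddValuation L (WithTop ℤ))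

/-- Valuations over `k`, with two derivations that do not lower the valuation, such that an element
which is algebraic over `k` in the residue field has its residue in `k`. -/
structure IsLogValuation (D₁ D₂ : Derivation k L L) : Prop where
  le_algebraMap : ∀ c : k, 0 ≤ v (algebraMap k L c)
  le_left : ∀ x, v x ≤ v (D₁ x)
  le_right : ∀ x, v x ≤ v (D₂ x)
  exists_residue : ∀ (u : L) (Q : Polynomial k), 0 ≤ v u → Q ≠ 0 → 0 < v (Polynomial.aeval u Q) →
    ∃ c : k, 0 < v (u - algebraMap k L c)

variable {v} {D₁ D₂ : Derivation k L L}

namespace IsLogValuation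

theorem add_le_derivBracket (h : IsLogValuation v D₁ D₂) (x y : L) :
    v x + v y ≤ v (derivBracket D₁ D₂ x y) := by
  apply v.map_le_sub <;> rw [v.map_mul]
  · exact add_le_add (h.le_left x) (h.le_right y)
  · exact add_le_add (h.le_right x) (h.le_left y)

/-- Monomials divisible by `X 0` have positive value, so the residue of `p(x, y)` is seen on the
exceptional line alone. -/
theorem aeval_sub_pos (h : IsLogValuation v D₁ D₂) {x y : L} (hx : 0 < v x) (hy : 0 ≤ v y)
    (p : MvPolynomial (Fin 2) k) :
    0 < v (aeval ![x, y] p - aeval ![0, y] p) := by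
  rw [aeval_fin_two_eq_sum, aeval_fin_two_eq_sum, ← Finset.sum_sub_distrib]
  refine v.map_lt_sum (by simp) fun m _ => ?_
  rw [← mul_sub, ← sub_mul, v.map_mul, v.map_mul, v.map_pow]
  rcases Nat.eq_zero_or_pos (m 0) with h0 | h0
  · simp [h0]
  · rw [zero_pow h0.ne', sub_zero, v.map_pow]
    have h1 : 0 < m 0 • v x := by
      rw [← Nat.sub_add_cancel h0, succ_nsmul]
      exact hx.trans_le (le_add_of_nonneg_left (nsmul_nonneg hx.le _))
    exact (h1.trans_le (le_add_of_nonneg_right (nsmul_nonneg hy _))).trans_le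
      (le_add_of_nonneg_left (h.le_algebraMap _))

theorem aeval_zero_left (x : L) (p : MvPolynomial (Fin 2) k) :
    aeval ![0, x] p = Polynomial.aeval x (aeval ![0, Polynomial.X] p : Polynomial k) := by
  have := comp_aeval_apply (R := k) ![(0 : Polynomial k), Polynomial.X] (Polynomial.aeval x :
      Polynomial k →ₐ[k] L) p
  rw [this]
  congr 1
  ext i
  fin_cases i <;> simp

theorem aeval_nonneg (h : IsLogValuation v D₁ D₂) {x y : L} (hx : 0 ≤ v x) (hy : 0 ≤ v y)
    (p : MvPolynomial (Fin 2) k) : 0 ≤ v (aeval ![x, y] p) := by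
  rw [aeval_fin_two_eq_sum]
  refine v.map_le_sum fun m _ => ?_
  rw [v.map_mul, v.map_mul, v.map_pow, v.map_pow]
  exact add_nonneg (h.le_algebraMap _) (add_nonneg (nsmul_nonneg hx _) (nsmul_nonneg hy _))

/-- Here `p₁` is the strict transform. On the exceptional line only the monomials of degree `n`
survive; they have distinct exponents `m 1 ≤ n`, which gives both nonvanishing and the degree bound.
-/
theorem exists_blowUp (p : MvPolynomial (Fin 2) k) (n : ℕ)
    (hn : ∀ m, coeff m p ≠ 0 → n ≤ m 0 + m 1) (m₀ : Fin 2 →₀ ℕ) (hm₀ : coeff m₀ p ≠ 0)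
    (hm₀n : m₀ 0 + m₀ 1 = n) :
    ∃ p₁ : MvPolynomial (Fin 2) k,
      (∀ x y : L, aeval ![x, x * y] p = x ^ n * aeval ![x, y] p₁) ∧
      (aeval ![0, Polynomial.X] p₁ : Polynomial k) ≠ 0 ∧
      (aeval ![0, Polynomial.X] p₁ : Polynomial k).natDegree ≤ n := by
  set Q : MvPolynomial (Fin 2) k := ∑ m ∈ p.support, C (coeff m p) * (X 0 ^ (m 0 + m 1 - n) *
      X 1 ^ m 1) with hQ
  have hQ0 : (aeval ![0, Polynomial.X] Q : Polynomial k) =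
      ∑ m ∈ p.support, Polynomial.C (coeff m p) *
        ((0 : Polynomial k) ^ (m 0 + m 1 - n) * Polynomial.X ^ m 1) := by
    simp only [hQ, map_sum, map_mul, map_pow, aeval_X, aeval_C, Matrix.cons_val_zero,
      Matrix.cons_val_one, Polynomial.algebraMap_eq]
  refine ⟨Q, fun x y => ?_, fun h0 => ?_, ?_⟩
  · rw [aeval_fin_two_eq_sum, hQ, map_sum, Finset.mul_sum]
    refine Finset.sum_congr rfl fun m hm => ?_
    have := hn m (mem_support_iff.1 hm)
    obtain ⟨r, hr⟩ := Nat.exists_eq_add_of_le this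
    have hr' : m 0 + m 1 - n = r := by omega
    simp only [map_mul, map_pow, aeval_X, aeval_C, Matrix.cons_val_zero, Matrix.cons_val_one, hr']
    rw [mul_pow, ← mul_assoc (x ^ m 0), ← pow_add, hr, pow_add]
    ring
  · apply hm₀
    have h1 := congrArg (fun q => Polynomial.coeff q (m₀ 1)) h0
    rw [hQ0] at h1
    simp only [Polynomial.finsetSum_coeff, Polynomial.coeff_C_mul, Polynomial.coeff_zero] at h1
    rw [Finset.sum_eq_single m₀] at h1
    · simpa [hm₀n] using h1
    · intro m hm hne
      have hle := hn m (mem_support_iff.1 hm)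
      rcases Nat.eq_zero_or_pos (m 0 + m 1 - n) with h2 | h2
      · rw [h2, pow_zero, one_mul, Polynomial.coeff_X_pow, if_neg, mul_zero]
        intro h3
        apply hne
        ext i
        fin_cases i
        · simp; omega
        · exact h3.symm
      · rw [zero_pow h2.ne', zero_mul, Polynomial.coeff_zero, mul_zero]
    · intro h; exact absurd (notMem_support_iff.1 h) hm₀
  · rw [hQ0]
    refine Polynomial.natDegree_sum_le_of_forall_le _ _ fun m hm => ?_
    have hle := hn m (mem_support_iff.1 hm)
    rcases Nat.eq_zero_or_pos (m 0 + m 1 - n) with h2 | h2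
    · rw [h2, pow_zero, one_mul]
      exact (Polynomial.natDegree_C_mul_X_pow_le _ _).trans (by omega)
    · rw [zero_pow h2.ne', zero_mul, mul_zero, Polynomial.natDegree_zero]; omega

/-- Along a chain of blow-ups of a smooth surface, the valuation of a function is bounded by its
multiplicity times the valuation of the volume form. -/
theorem aeval_le_mul (h : IsLogValuation v D₁ D₂) (x y : L) (hx : 0 < v x) (hy : 0 < v y) (J : ℤ)
    (hJ : v (derivBracket D₁ D₂ x y) = J) (p : MvPolynomial (Fin 2) k) (n : ℕ)
    (hp : ∃ m, coeff m p ≠ 0 ∧ m 0 + m 1 ≤ n) :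
    v (aeval ![x, y] p) ≤ (n * J : ℤ) := by
  -- Each blow-up lowers `J` by the value of the smaller coordinate, and `J ≥ v x + v y > 0` keeps
  -- the descent finite.
  induction hN : J.toNat using Nat.strong_induction_on generalizing x y J p n with
  | _ N ih =>
  have hJle := h.add_le_derivBracket x y
  wlog hxy : v x ≤ v y generalizing x y p
  · have := this y x hy hx (by rw [derivBracket_swap, v.map_neg, hJ]) (rename (Equiv.swap 0 1) p) ?_
      (by rw [derivBracket_swap, v.map_neg, add_comm]; exact hJle) (le_of_not_ge hxy)
    · rw [aeval_rename] at this
      convert this using 4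
      ext i; fin_cases i <;> simp
    · obtain ⟨m, hm, hmn⟩ := hp
      refine ⟨m.mapDomain (Equiv.swap 0 1), ?_, ?_⟩
      · rwa [coeff_rename_mapDomain _ (Equiv.swap 0 1).injective]
      · rw [Finsupp.mapDomain_equiv_apply, Finsupp.mapDomain_equiv_apply]
        simpa [add_comm] using hmn
  rw [hJ] at hJle
  have hytop : v y ≠ ⊤ := fun h => by simp [h] at hJle
  have hxtop : v x ≠ ⊤ := fun h => by simp [h] at hJle
  obtain ⟨e, he⟩ := WithTop.ne_top_iff_exists.1 hytop
  obtain ⟨d, hd⟩ := WithTop.ne_top_iff_exists.1 hxtop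
  have hx0 : x ≠ 0 := by rintro rfl; simp at hxtop
  rw [← hd, ← he, ← WithTop.coe_add, WithTop.coe_le_coe] at hJle
  rw [← hd] at hx
  rw [← he] at hy
  rw [← hd, ← he, WithTop.coe_le_coe] at hxy
  norm_cast at hx hy
  -- the multiplicity of `p`
  have hex : ∃ r, ∃ m, coeff m p ≠ 0 ∧ m 0 + m 1 = r := by
    obtain ⟨m, hm, -⟩ := hp; exact ⟨_, m, hm, rfl⟩
  classical
  obtain ⟨m₀, hm₀, hm₀r⟩ := Nat.find_spec hex
  -- The exact multiplicity `r ≤ n` is the power of `x` that factors out.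
  set r := Nat.find hex with hr
  have hrmin : ∀ m, coeff m p ≠ 0 → r ≤ m 0 + m 1 := fun m hm => Nat.find_min' hex ⟨m, hm, rfl⟩
  have hrn : r ≤ n := by
    obtain ⟨m, hm, hmn⟩ := hp; exact (hrmin m hm).trans hmn
  obtain ⟨p₁, hp₁, hQ0, hQn⟩ := exists_blowUp (L := L) p r hrmin m₀ hm₀ hm₀r
  set z := y / x with hz
  have hyz : y = x * z := by rw [hz, mul_div_cancel₀ _ hx0]
  have hvz : v z = (e - d : ℤ) := by
    have h1 := v.map_mul x z
    rw [← hyz, ← he, ← hd] at h1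
    have hzt : v z ≠ ⊤ := fun h => by simp [h] at h1
    obtain ⟨f, hf⟩ := WithTop.ne_top_iff_exists.1 hzt
    rw [← hf] at h1 ⊢
    norm_cast at h1 ⊢
    omega
  have hz0 : 0 ≤ v z := by rw [hvz]; norm_cast; omega
  rw [hyz, hp₁, v.map_mul, v.map_pow, ← hd]
  have hbr : v (derivBracket D₁ D₂ x z) = (J - d : ℤ) := by
    rw [hyz, derivBracket_mul_right_self, v.map_mul, ← hd] at hJ
    have hzt : v (derivBracket D₁ D₂ x z) ≠ ⊤ := fun h => by simp [h] at hJ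
    obtain ⟨f, hf⟩ := WithTop.ne_top_iff_exists.1 hzt
    rw [← hf] at hJ ⊢
    norm_cast at hJ ⊢
    omega
  -- If the strict transform misses the centre of `v`, the value is just `r d`, with `d < J`.
  rcases (h.aeval_nonneg (x := x) (y := z) (by rw [← hd]; exact_mod_cast hx.le)
      hz0 p₁).eq_or_lt with h0 | h0
  · rw [← h0, add_zero]
    norm_cast
    rw [nsmul_eq_mul]
    have : (r : ℤ) ≤ n := by exact_mod_cast hrn
    nlinarith
  · have h1 : 0 < v (Polynomial.aeval z (aeval ![0, Polynomial.X] p₁ : Polynomial k)) := by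
      rw [← aeval_zero_left]
      have h2 := h.aeval_sub_pos (x := x) (y := z) (by rw [← hd]; exact_mod_cast hx) hz0 p₁
      have h3 := v.map_sub (aeval ![x, z] p₁) (aeval ![x, z] p₁ - aeval ![0, z] p₁)
      rw [sub_sub_cancel] at h3
      exact lt_of_lt_of_le (lt_min h0 h2) h3
    -- The residue of `z` is a root of the restricted polynomial, so the next centre is a
    -- `k`-rational point of the exceptional line. Induction there gives `r d + r (J - d) = r J`.
    obtain ⟨c, hc⟩ := h.exists_residue z _ hz0 hQ0 h1
    have h2 := ih (J - d).toNat (by omega) x (z - algebraMap k L c)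
        (by rw [← hd]; exact_mod_cast hx) hc (J - d)
      (by rw [derivBracket_sub_algebraMap, hbr]) (aeval ![X 0, X 1 + C c] p₁) r ?_ rfl
    · have h3 : aeval ![x, z - algebraMap k L c] (aeval ![X 0, X 1 + C c] p₁) = aeval ![x, z] p₁ := by
        rw [comp_aeval_apply]
        congr 2
        ext i; fin_cases i <;> simp
      rw [h3] at h2
      refine (add_le_add_right h2 _).trans ?_
      norm_cast
      rw [nsmul_eq_mul]
      have : (r : ℤ) ≤ n := by exact_mod_cast hrn
      nlinarith
    · have h3 : (aeval ![0, Polynomial.X] (aeval ![X 0, X 1 + C c] p₁ : MvPolynomial (Fin 2) k) :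
          Polynomial k) =
          (aeval ![0, Polynomial.X] p₁ : Polynomial k).comp (Polynomial.X + Polynomial.C c) := by
        change _ = Polynomial.aeval _ _
        rw [comp_aeval_apply, comp_aeval_apply]
        congr 2
        ext i; fin_cases i <;> simp
      set Q := (aeval ![0, Polynomial.X] p₁ : Polynomial k).comp (Polynomial.X + Polynomial.C c) with hQ
      have h4 : Q.natDegree ≤ r := by
        rw [hQ, Polynomial.natDegree_comp, Polynomial.natDegree_X_add_C, mul_one]; exact hQn
      -- The multiplicity at the new centre does not exceed `r`: the leading term on the exceptional
      -- line is a monomial of degree at most `r`.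
      refine ⟨Finsupp.single 1 Q.natDegree, ?_, by simpa using h4⟩
      rw [← coeff_aeval_zero_X, h3, Polynomial.coeff_natDegree, Polynomial.leadingCoeff_ne_zero, hQ, Ne,
        Polynomial.comp_X_add_C_eq_zero_iff]
      exact hQ0

end IsLogValuation
end Valuation

/-! ### Toric coordinates and the value of a polynomial in the components -/

section

theorem AddValuation.eq_coe_of_mul {L : Type*} [Field L] (v : AddValuation L (WithTop ℤ)) {x y : L}
    {m n : ℤ} (hx : v x = m) (hxy : v (x * y) = n) : v y = (n - m : ℤ) := by
  rw [v.map_mul, hx] at hxy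
  have ht : v y ≠ ⊤ := fun h => by simp [h] at hxy
  obtain ⟨f, hf⟩ := WithTop.ne_top_iff_exists.1 ht
  rw [← hf] at hxy ⊢
  norm_cast at hxy ⊢
  omega

theorem AddValuation.pow_eq_coe {L : Type*} [Field L] (v : AddValuation L (WithTop ℤ)) {x : L}
    {m : ℤ} (hx : v x = m) (n : ℕ) : v (x ^ n) = (n * m : ℤ) := by
  rw [v.map_pow, hx]
  norm_cast

theorem AddValuation.mul_eq_coe {L : Type*} [Field L] (v : AddValuation L (WithTop ℤ)) {x y : L}
    {m n : ℤ} (hx : v x = m) (hy : v y = n) : v (x * y) = (m + n : ℤ) := by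
  rw [v.map_mul, hx, hy]
  norm_cast

theorem AddValuation.ne_zero_of_eq_coe {L : Type*} [Field L] (v : AddValuation L (WithTop ℤ)) {x : L}
    {m : ℤ} (hx : v x = m) : x ≠ 0 := by
  rintro rfl; simp at hx

/-- The multiplicity of a nonzero root is at most the width of the support. -/
theorem Polynomial.rootMultiplicity_add_natTrailingDegree_le {k : Type*} [Field k]
    {Q : Polynomial k} (hQ : Q ≠ 0) {c : k} (hc : c ≠ 0) :
    Q.rootMultiplicity c + Q.natTrailingDegree ≤ Q.natDegree := by
  classical
  obtain ⟨R, hR⟩ : Polynomial.X ^ Q.natTrailingDegree ∣ Q :=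
    Polynomial.X_pow_dvd_iff.2 fun d hd => Polynomial.coeff_eq_zero_of_lt_natTrailingDegree hd
  have hR0 : R ≠ 0 := by rintro rfl; simp at hR; exact hQ hR
  have h1 : Q.rootMultiplicity c = R.rootMultiplicity c := by
    conv_lhs => rw [hR]
    rw [Polynomial.rootMultiplicity_mul (mul_ne_zero (pow_ne_zero _ Polynomial.X_ne_zero) hR0),
      Polynomial.rootMultiplicity_eq_zero, zero_add]
    simp [Polynomial.IsRoot, hc]
  have h2 : R.rootMultiplicity c ≤ R.natDegree := by
    rw [← Polynomial.count_roots]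
    exact (Multiset.count_le_card _ _).trans R.card_roots'
  have h3 : Q.natDegree = Q.natTrailingDegree + R.natDegree := by
    conv_lhs => rw [hR]
    rw [Polynomial.natDegree_mul (pow_ne_zero _ Polynomial.X_ne_zero) hR0, Polynomial.natDegree_X_pow]
  omega

theorem Nat.Coprime.exists_mul_eq_mul_add_one {a b : ℕ} (h : a.Coprime b) (ha : 0 < a) (hb : 0 < b) :
    ∃ x y : ℕ, a * x = y * b + 1 := by
  obtain ⟨x, y, hxy⟩ := Nat.isCoprime_iff_coprime.2 h
  -- Bézout coefficients are shifted along `(b, -a)`; this multiple is large enough to make the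
  -- first nonnegative and the second nonpositive.
  set t := |x| + |y| with ht
  have h1 : 0 ≤ x + t * b := by
    have := neg_abs_le x
    have := abs_nonneg y
    have : (1 : ℤ) ≤ b := by exact_mod_cast hb
    nlinarith [abs_nonneg x]
  have h2 : 0 ≤ t * a - y := by
    have := le_abs_self y
    have := abs_nonneg x
    have : (1 : ℤ) ≤ a := by exact_mod_cast ha
    nlinarith [abs_nonneg y]
  refine ⟨(x + t * b).toNat, (t * a - y).toNat, ?_⟩
  zify
  rw [Int.toNat_of_nonneg h1, Int.toNat_of_nonneg h2]
  linear_combination hxy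

variable {k : Type*} [Field k]

/-- `N` is the top weight of `P`, and the restriction of `p` to `s⁻¹ = 0` is the top-weight face
written in `u`. On this face the exponents of `u` lie between `yN/a` and `xN/b`, an interval of
length `N/(ab)` since `ax - yb = 1`. This length bounds the multiplicity of a nonzero root. -/
theorem MvPolynomial.exists_toric (P : MvPolynomial (Fin 2) k) (hP : P ≠ 0) (a b x y : ℕ)
    (hxy : a * x = y * b + 1) :
    ∃ (N : ℕ) (p : MvPolynomial (Fin 2) k),
      (∀ m, coeff m P ≠ 0 → a * m 0 + b * m 1 ≤ N) ∧
      (∀ {L : Type _} [Field L] [Algebra k L] (s u : L), s ≠ 0 →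
        aeval ![s ^ a * u ^ y, s ^ b * u ^ x] P = s ^ N * aeval ![s⁻¹, u] p) ∧
      (aeval ![0, Polynomial.X] p : Polynomial k) ≠ 0 ∧
      ∀ c : k, c ≠ 0 →
        (aeval ![0, Polynomial.X] p : Polynomial k).rootMultiplicity c * (a * b) ≤ N := by
  obtain ⟨m₀, hm₀, hmax⟩ := P.support.exists_max_image (fun m => a * m 0 + b * m 1)
    (support_nonempty.2 hP)
  set N := a * m₀ 0 + b * m₀ 1 with hN
  replace hmax : ∀ m, coeff m P ≠ 0 → a * m 0 + b * m 1 ≤ N :=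
    fun m hm => hmax m (mem_support_iff.2 hm)
  set p : MvPolynomial (Fin 2) k := ∑ m ∈ P.support,
    C (coeff m P) * (X 0 ^ (N - (a * m 0 + b * m 1)) * X 1 ^ (y * m 0 + x * m 1)) with hp
  have hQ : (aeval ![0, Polynomial.X] p : Polynomial k) = ∑ m ∈ P.support, Polynomial.C (coeff m P) *
      (0 ^ (N - (a * m 0 + b * m 1)) * Polynomial.X ^ (y * m 0 + x * m 1)) := by
    simp only [hp, map_sum, map_mul, map_pow, aeval_X, aeval_C, Matrix.cons_val_zero,
      Matrix.cons_val_one, Polynomial.algebraMap_eq]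
  have hterm (m : Fin 2 →₀ ℕ) (E : ℕ) (hm : coeff m P ≠ 0) :
      (Polynomial.C (coeff m P) * ((0 : Polynomial k) ^ (N - (a * m 0 + b * m 1)) *
        Polynomial.X ^ (y * m 0 + x * m 1))).coeff E ≠ 0 ↔
      a * m 0 + b * m 1 = N ∧ y * m 0 + x * m 1 = E := by
    rw [Polynomial.coeff_C_mul]
    have hle := hmax m hm
    rcases Nat.eq_zero_or_pos (N - (a * m 0 + b * m 1)) with h | h
    · have h' : a * m 0 + b * m 1 = N := by omega
      rw [h, pow_zero, one_mul, Polynomial.coeff_X_pow]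
      simp [h', hm, eq_comm (a := E)]
    · rw [zero_pow h.ne', zero_mul, Polynomial.coeff_zero, mul_zero]
      simp only [ne_eq, not_true_eq_false, false_iff, not_and]
      omega
  have hterm0 (m : Fin 2 →₀ ℕ) (E : ℕ) (hm : coeff m P ≠ 0)
      (h : ¬ (a * m 0 + b * m 1 = N ∧ y * m 0 + x * m 1 = E)) :
      (Polynomial.C (coeff m P) * ((0 : Polynomial k) ^ (N - (a * m 0 + b * m 1)) *
        Polynomial.X ^ (y * m 0 + x * m 1))).coeff E = 0 := by
    by_contra h'
    exact h ((hterm m E hm).1 h')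
  have hQ0 : (aeval ![0, Polynomial.X] p : Polynomial k) ≠ 0 := by
    intro h0
    have h1 := congrArg (fun q => Polynomial.coeff q (y * m₀ 0 + x * m₀ 1)) h0
    rw [hQ] at h1
    simp only [Polynomial.finsetSum_coeff, Polynomial.coeff_zero] at h1
    -- No cancellation: weight and exponent of `u` determine the monomial, the change of exponents
    -- being unimodular.
    rw [Finset.sum_eq_single m₀] at h1
    · exact (hterm m₀ _ (mem_support_iff.1 hm₀)).2 ⟨rfl, rfl⟩ h1
    · intro m hm hne
      apply hterm0 m _ (mem_support_iff.1 hm)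
      rintro ⟨e1, e2⟩
      apply hne
      have f0 : (m 0 : ℤ) = m₀ 0 := by
        zify at hxy e1 e2 hN
        linear_combination (m₀ 0 - m 0) * hxy + x * (e1 + hN) - b * e2
      have f1 : (m 1 : ℤ) = m₀ 1 := by
        zify at hxy e1 e2 hN
        linear_combination (m₀ 1 - m 1) * hxy - y * (e1 + hN) + a * e2
      ext i
      fin_cases i
      · exact_mod_cast f0
      · exact_mod_cast f1
    · exact fun h => absurd hm₀ h
  have hex (E : ℕ) (hE : (aeval ![0, Polynomial.X] p : Polynomial k).coeff E ≠ 0) :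
      b * E ≤ x * N ∧ y * N ≤ a * E := by
    rw [hQ, Polynomial.finsetSum_coeff] at hE
    obtain ⟨m, hm, hne⟩ := Finset.exists_ne_zero_of_sum_ne_zero hE
    obtain ⟨e1, e2⟩ := (hterm m E (mem_support_iff.1 hm)).1 hne
    have f0 : (b : ℤ) * E + m 0 = x * N := by
      zify at hxy e1 e2
      linear_combination x * e1 - b * e2 - m 0 * hxy
    have f1 : (y : ℤ) * N + m 1 = a * E := by
      zify at hxy e1 e2
      linear_combination -y * e1 + a * e2 - m 1 * hxy
    constructor
    · zify; have : (0 : ℤ) ≤ m 0 := by positivity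
      linarith
    · zify; have : (0 : ℤ) ≤ m 1 := by positivity
      linarith
  refine ⟨N, p, hmax, fun {L} _ _ s u hs => ?_, hQ0, fun c hc => ?_⟩
  · rw [aeval_fin_two_eq_sum, hp, map_sum, Finset.mul_sum]
    refine Finset.sum_congr rfl fun m hm => ?_
    obtain ⟨r, hr⟩ := Nat.exists_eq_add_of_le (hmax m (mem_support_iff.1 hm))
    simp only [map_mul, map_pow, aeval_X, aeval_C, Matrix.cons_val_zero, Matrix.cons_val_one]
    rw [hr, Nat.add_sub_cancel_left]
    have : s ^ (a * m 0 + b * m 1 + r) * s⁻¹ ^ r = s ^ (a * m 0 + b * m 1) := by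
      rw [pow_add, mul_assoc, ← mul_pow, mul_inv_cancel₀ hs, one_pow, mul_one]
    calc _ = algebraMap k L (coeff m P) * (s ^ (a * m 0 + b * m 1) * u ^ (y * m 0 + x * m 1)) := by
          rw [mul_pow, mul_pow, ← pow_mul, ← pow_mul, ← pow_mul, ← pow_mul, pow_add, pow_add]; ring
      _ = _ := by rw [← this]; ring
  · set Q := (aeval ![0, Polynomial.X] p : Polynomial k)
    have h1 := Polynomial.rootMultiplicity_add_natTrailingDegree_le hQ0 hc
    have h2 := (hex Q.natDegree (by simpa using hQ0)).1
    have h3 := (hex Q.natTrailingDegree (by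
      rw [Ne, Polynomial.coeff_natTrailingDegree_eq_zero]; exact hQ0)).2
    zify at h1 h2 h3 hxy ⊢
    have h4 : (Q.rootMultiplicity c : ℤ) * (a * b) ≤ (Q.natDegree - Q.natTrailingDegree) * (a * b) :=
      mul_le_mul_of_nonneg_right (by linarith) (by positivity)
    have h5 : (a : ℤ) * (b * Q.natDegree) ≤ a * (x * N) := mul_le_mul_of_nonneg_left h2 (by positivity)
    have h6 : (b : ℤ) * (y * N) ≤ b * (a * Q.natTrailingDegree) :=
        mul_le_mul_of_nonneg_left h3 (by positivity)
    have h7 : (a : ℤ) * (x * N) - b * (y * N) = N := by linear_combination N * hxy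
    linarith

variable {L : Type _} [Field L] [Algebra k L]
  {v : AddValuation L (WithTop ℤ)} {D₁ D₂ : Derivation k L L}

/-- Either the top-weight face does not cancel and the value is minus the top weight, or it vanishes
at the residue `c` of `u`. In the latter case `aeval_le_mul` bounds the gain by `μ J`, where `μ` is
the multiplicity of the root `c`, while `exists_toric` gives `μ a' b' ≤ N`; irreducibility of the
degrees makes the first bound too small to lift the value above `-2`. -/
theorem IsLogValuation.aeval_le_of_forall_not_lt (h : IsLogValuation v D₁ D₂) (f g : L) (a b : ℕ)
    (ha : 0 < a) (hb : 0 < b) (hf : v f = (-a : ℤ)) (hg : v g = (-b : ℤ))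
    (hfg : v (derivBracket D₁ D₂ f g) = (-2 : ℤ))
    (h1 : ∀ (c : k) (q : ℕ), ¬ v g < v (g - algebraMap k L c * f ^ q))
    (h2 : ∀ (c : k) (q : ℕ), ¬ v f < v (f - algebraMap k L c * g ^ q))
    (P : MvPolynomial (Fin 2) k) (m : Fin 2 →₀ ℕ) (hm : coeff m P ≠ 0) :
    v (aeval ![f, g] P) ≤ (-(a * m 0 + b * m 1) : ℤ) ∨ v (aeval ![f, g] P) ≤ (-2 : ℤ) := by
  obtain ⟨a', b', hco, ha', hb'⟩ := Nat.exists_coprime a b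
  set d := a.gcd b with hd
  have hd0 : 0 < d := Nat.gcd_pos_of_pos_left _ ha
  have ha0 : 0 < a' := Nat.pos_of_ne_zero (by rintro rfl; omega)
  have hb0 : 0 < b' := Nat.pos_of_ne_zero (by rintro rfl; omega)
  obtain ⟨x, y, hxy⟩ := hco.exists_mul_eq_mul_add_one ha0 hb0
  have hf0 : f ≠ 0 := v.ne_zero_of_eq_coe hf
  have hg0 : g ≠ 0 := v.ne_zero_of_eq_coe hg
  -- Unimodular monomial coordinates: `u` is a unit for `v` and `s` has value `-d`, where `d` is the
  -- gcd of `a` and `b`.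
  set s := f ^ x / g ^ y with hs
  set u := g ^ a' / f ^ b' with hu
  have hs0 : s ≠ 0 := div_ne_zero (pow_ne_zero _ hf0) (pow_ne_zero _ hg0)
  have hu0 : u ≠ 0 := div_ne_zero (pow_ne_zero _ hg0) (pow_ne_zero _ hf0)
  have hfe : s ^ a' * u ^ y = f := by
    rw [hs, hu, div_pow, div_pow, ← pow_mul, ← pow_mul, ← pow_mul, ← pow_mul, mul_comm x a', hxy,
      mul_comm b' y, mul_comm y a', pow_succ]
    field_simp
  have hge : s ^ b' * u ^ x = g := by
    rw [hs, hu, div_pow, div_pow, ← pow_mul, ← pow_mul, ← pow_mul, ← pow_mul, mul_comm x b', hxy,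
      pow_succ]
    field_simp
  have hzxy : (a' : ℤ) * x = y * b' + 1 := by exact_mod_cast hxy
  have hza : (a : ℤ) = a' * d := by exact_mod_cast ha'
  have hzb : (b : ℤ) = b' * d := by exact_mod_cast hb'
  have hvs : v s = (-d : ℤ) := by
    have e : g ^ y * s = f ^ x := by rw [hs, mul_div_cancel₀ _ (pow_ne_zero _ hg0)]
    rw [v.eq_coe_of_mul (v.pow_eq_coe hg y) (by rw [e]; exact v.pow_eq_coe hf x)]
    congr 1
    rw [hza, hzb]; linear_combination (-d : ℤ) * hzxy
  have hvu : v u = (0 : ℤ) := by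
    have e : f ^ b' * u = g ^ a' := by rw [hu, mul_div_cancel₀ _ (pow_ne_zero _ hf0)]
    rw [v.eq_coe_of_mul (v.pow_eq_coe hf b') (by rw [e]; exact v.pow_eq_coe hg a')]
    congr 1
    rw [hza, hzb]; ring
  have hvsi : v s⁻¹ = (d : ℤ) := by
    rw [v.eq_coe_of_mul (n := 0) hvs (by rw [mul_inv_cancel₀ hs0, v.map_one]; rfl)]
    congr 1; ring
  -- The bracket of `s` and `u` has value `a + b - d - 2` by `derivBracket_monomials`; inverting `s`
  -- adds `2d`.
  obtain ⟨J, hJ⟩ : ∃ J : ℤ, J = a + b + d - 2 := ⟨_, rfl⟩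
  have hbr : v (derivBracket D₁ D₂ s⁻¹ u) = J := by
    have e := derivBracket_monomials D₁ D₂ s u a' y b' x hxy
    rw [hfe, hge] at e
    have e1 : v (derivBracket D₁ D₂ s u) = (a + b - d - 2 : ℤ) := by
      rw [v.eq_coe_of_mul (v.mul_eq_coe hf hg)
        (by rw [← e]; exact v.mul_eq_coe (v.mul_eq_coe hvs hvu) hfg)]
      congr 1; ring
    rw [derivBracket_inv_left, v.map_neg, v.mul_eq_coe (v.pow_eq_coe hvsi 2) e1]
    rw [hJ]; congr 1; push_cast; ring
  obtain ⟨N, p, hN, hPp, hQ0, hmult⟩ := exists_toric P (by rintro rfl; simp at hm) a' b' x y hxy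
  have hP : aeval ![f, g] P = s ^ N * aeval ![s⁻¹, u] p := by
    rw [← hPp s u hs0, hfe, hge]
  have hvsN : v (s ^ N) = (-(N * d) : ℤ) := by rw [v.pow_eq_coe hvs]; congr 1; ring
  have hleft : (-(N * d) : ℤ) ≤ -(a * m 0 + b * m 1) := by
    have h3 : ((a' * m 0 + b' * m 1 : ℕ) : ℤ) * d ≤ N * d := 
      mul_le_mul_of_nonneg_right (by exact_mod_cast hN m hm) (by positivity)
    rw [hza, hzb]; push_cast at h3; linarith
  have hspos : 0 < v s⁻¹ := by rw [hvsi]; exact_mod_cast hd0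
  have hunn : 0 ≤ v u := by rw [hvu]; rfl
  rw [hP, v.map_mul, hvsN]
  rcases (h.aeval_nonneg hspos.le hunn p).eq_or_lt with h0 | h0
  · left
    rw [← h0, add_zero]
    exact_mod_cast hleft
  have h3 : 0 < v (Polynomial.aeval u (aeval ![0, Polynomial.X] p : Polynomial k)) := by
    rw [← aeval_zero_left]
    have h4 := h.aeval_sub_pos hspos hunn p
    have h5 := v.map_sub (aeval ![s⁻¹, u] p) (aeval ![s⁻¹, u] p - aeval ![0, u] p)
    rw [sub_sub_cancel] at h5
    exact lt_of_lt_of_le (lt_min h0 h4) h5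
  obtain ⟨c, hc⟩ := h.exists_residue u _ hunn hQ0 h3
  have hc0 : c ≠ 0 := by
    rintro rfl
    rw [map_zero, sub_zero, hvu] at hc
    exact lt_irrefl _ hc
  have key {z w : L} {n : ℤ} (hz : v z = n) (hw : 0 < v w) : v z < v (z * w) := by
    rw [v.map_mul, hz]
    rcases eq_or_ne (v w) ⊤ with ht | ht
    · rw [ht]; simp
    · obtain ⟨j, hj⟩ := WithTop.ne_top_iff_exists.1 ht
      rw [← hj] at hw ⊢
      norm_cast at hw ⊢
      omega
  -- If `a'` were `1`, then `u = g / f ^ b'`, and its residue `c` would let `c f ^ b'` cancel the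
  -- leading part of `g`, against `h1`. The same argument with `c⁻¹` excludes `b' = 1`.
  have ha2 : a' ≠ 1 := by
    intro e
    apply h1 c b'
    have e2 : g - algebraMap k L c * f ^ b' = f ^ b' * (u - algebraMap k L c) := by
      rw [mul_sub, hu, mul_div_cancel₀ _ (pow_ne_zero _ hf0), e, pow_one]; ring
    have e3 := v.pow_eq_coe hf b'
    have e4 : v g = v (f ^ b') := by
      rw [hg, e3, hza, hzb, e]; congr 1; push_cast; ring
    rw [e2, e4]
    exact key e3 hc
  have hb2 : b' ≠ 1 := by
    intro e
    apply h2 c⁻¹ a'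
    have hC : algebraMap k L c ≠ 0 := by simpa using hc0
    have e2 : f - algebraMap k L c⁻¹ * g ^ a' = f * (-(algebraMap k L c⁻¹) *
        (u - algebraMap k L c)) := by
      rw [hu, e, pow_one, map_inv₀]; field_simp; ring
    rw [e2]
    refine key hf ?_
    rw [v.map_mul, v.map_neg]
    exact hc.trans_le (le_add_of_nonneg_left (h.le_algebraMap _))
  set Q := (aeval ![0, Polynomial.X] p : Polynomial k) with hQ
  set μ := Q.rootMultiplicity c with hμ
  have h4 := h.aeval_le_mul s⁻¹ (u - algebraMap k L c) hspos hc _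
    (by rw [derivBracket_sub_algebraMap, hbr]) (aeval ![X 0, X 1 + C c] p) μ ?_
  · have h5 : aeval ![s⁻¹, u - algebraMap k L c] (aeval ![X 0, X 1 + C c] p) = aeval ![s⁻¹, u] p := by
      rw [comp_aeval_apply]
      congr 2
      ext i; fin_cases i <;> simp
    rw [h5] at h4
    have h6 := add_le_add_right h4 ((-(N * d) : ℤ) : WithTop ℤ)
    norm_cast at h6
    rcases Nat.eq_zero_or_pos μ with h7 | h7
    · left
      refine h6.trans ?_
      rw [h7]
      norm_cast
      simpa using hleft
    · right
      refine h6.trans ?_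
      norm_cast
      have h8 : (μ : ℤ) * (a' * b') * d ≤ N * d := 
        mul_le_mul_of_nonneg_right (by exact_mod_cast hmult c hc0) (by positivity)
      -- Coprime integers at least `2` cannot both be `2`. Hence `-Nd + μJ ≤ μ (d (a' + b' + 1 -
      -- a'b') - 2) ≤ -2`.
      have h9 : (a' : ℤ) + b' + 1 ≤ a' * b' := by
        have i1 : 2 ≤ a' := by omega
        have i2 : 2 ≤ b' := by omega
        have i3 : ¬ (a' = 2 ∧ b' = 2) := by
          rintro ⟨e1, e2⟩; rw [e1, e2] at hco; norm_num at hco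
        have i4 : a' + b' + 1 ≤ a' * b' := by
          rcases Nat.lt_or_ge 2 a' with i5 | i5
          · nlinarith
          · have : a' = 2 := by omega
            subst this
            omega
        exact_mod_cast i4
      have h10 : (1 : ℤ) ≤ μ := by exact_mod_cast h7
      have h11 : (1 : ℤ) ≤ d := by exact_mod_cast hd0
      have h12 : (0 : ℤ) ≤ μ * (d * (a' * b' - (a' + b' + 1))) :=
        mul_nonneg (by linarith) (mul_nonneg (by linarith) (by linarith))
      push_cast
      rw [hJ, hza, hzb]
      nlinarith
  · have h3 : (aeval ![0, Polynomial.X] (aeval ![X 0, X 1 + C c] p : MvPolynomial (Fin 2) k) :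
        Polynomial k) =
        Q.comp (Polynomial.X + Polynomial.C c) := by
      change _ = Polynomial.aeval _ _
      rw [hQ, comp_aeval_apply, comp_aeval_apply]
      congr 2
      ext i; fin_cases i <;> simp
    have hμ' : μ = (Q.comp (Polynomial.X + Polynomial.C c)).natTrailingDegree :=
      Polynomial.rootMultiplicity_eq_natTrailingDegree
    -- After translation to `c`, the lowest term on the line `s⁻¹ = 0` has degree `μ`, so the
    -- multiplicity at the centre is at most `μ`.
    refine ⟨Finsupp.single 1 μ, ?_, by simp⟩
    rw [← coeff_aeval_zero_X, h3, hμ', Ne, Polynomial.coeff_natTrailingDegree_eq_zero,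
      Polynomial.comp_X_add_C_eq_zero_iff]
    exact hQ0

end

/-! ### The degree valuation via Hahn series, and degree reduction -/

section

variable {k : Type*} [Field k]

namespace HahnSeries

/-- The derivation of a Hahn series ring that multiplies the coefficient at `g` by `χ g`. -/
noncomputable def eulerDerivation (k : Type*) [Field k] (χ : (ℤ ×ₗ ℤ) →+ ℤ) :
    Derivation k (HahnSeries (ℤ ×ₗ ℤ) k) (HahnSeries (ℤ ×ₗ ℤ) k) :=
  Derivation.mk'
    { toFun := fun x => ⟨fun g => (χ g : k) * x.coeff g, x.isPWO_support'.mono fun g hg => by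
        rw [Function.mem_support] at hg ⊢
        exact right_ne_zero_of_mul hg⟩
      map_add' := fun x y => by ext g; simp [mul_add]
      map_smul' := fun c x => by
        ext g
        change (χ g : k) * (c • x).coeff g = c • ((χ g : k) * x.coeff g)
        rw [coeff_smul, smul_eq_mul, smul_eq_mul]; ring }
    fun x y => by
      ext g
      set Dx : HahnSeries (ℤ ×ₗ ℤ) k := ⟨fun g => (χ g : k) * x.coeff g, _⟩ with hDx
      set Dy : HahnSeries (ℤ ×ₗ ℤ) k := ⟨fun g => (χ g : k) * y.coeff g, _⟩ with hDy
      have h1 : Dx.support ⊆ x.support := fun g hg => by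
        rw [mem_support] at hg ⊢
        exact right_ne_zero_of_mul hg
      have h2 : Dy.support ⊆ y.support := fun g hg => by
        rw [mem_support] at hg ⊢
        exact right_ne_zero_of_mul hg
      change (χ g : k) * (x * y).coeff g = (x * Dy + y * Dx).coeff g
      rw [mul_comm y, coeff_add, coeff_mul_right' y.isPWO_support h2,
        coeff_mul_left' x.isPWO_support h1, coeff_mul, Finset.mul_sum, ← Finset.sum_add_distrib]
      refine Finset.sum_congr rfl fun ij hij => ?_
      rw [Finset.mem_antidiagonal] at hij
      rw [← hij.2.2, map_add]
      change _ = x.coeff ij.1 * (χ ij.2 * y.coeff ij.2) + χ ij.1 * x.coeff ij.1 * y.coeff ij.2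
      push_cast; ring

theorem coeff_eulerDerivation (χ : (ℤ ×ₗ ℤ) →+ ℤ) (x : HahnSeries (ℤ ×ₗ ℤ) k) (g : ℤ ×ₗ ℤ) :
    (eulerDerivation k χ x).coeff g = χ g * x.coeff g := rfl

theorem eulerDerivation_single (χ : (ℤ ×ₗ ℤ) →+ ℤ) (g : ℤ ×ₗ ℤ) (c : k) :
    eulerDerivation k χ (single g c) = (χ g : k) • single g c := by
  ext g'
  rw [coeff_eulerDerivation, coeff_smul, smul_eq_mul]
  by_cases h : g' = g
  · rw [h]
  · rw [coeff_single_of_ne h, mul_zero, mul_zero]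

theorem addVal_le_eulerDerivation (χ : (ℤ ×ₗ ℤ) →+ ℤ) (x : HahnSeries (ℤ ×ₗ ℤ) k) :
    addVal _ k x ≤ addVal _ k (eulerDerivation k χ x) := by
  rw [addVal_apply, addVal_apply, le_orderTop_iff_forall]
  intro j hj
  rw [coeff_eulerDerivation, coeff_eq_zero_of_lt_orderTop hj, mul_zero]

/-- The first coordinate as a homomorphism on the lexicographic product. -/
def lexFst : (ℤ ×ₗ ℤ) →+ ℤ where
  toFun g := (ofLex g).1
  map_zero' := rfl
  map_add' _ _ := rfl

/-- The second coordinate as a homomorphism on the lexicographic product. -/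
def lexSnd : (ℤ ×ₗ ℤ) →+ ℤ where
  toFun g := (ofLex g).2
  map_zero' := rfl
  map_add' _ _ := rfl

theorem monotone_withTopMap_lexFst : Monotone lexFst.withTopMap :=
  Monotone.withTop_map Prod.Lex.monotone_fst_ofLex

/-- The valuation of rank one below the valuation of rank two of `k((ℤ ×ₗ ℤ))`. -/
noncomputable def fstVal (k : Type*) [Field k] :
    AddValuation (HahnSeries (ℤ ×ₗ ℤ) k) (WithTop ℤ) :=
  (addVal (ℤ ×ₗ ℤ) k).map lexFst.withTopMap rfl monotone_withTopMap_lexFst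

theorem fstVal_apply (x : HahnSeries (ℤ ×ₗ ℤ) k) :
    fstVal k x = lexFst.withTopMap (addVal _ k x) := rfl

theorem fstVal_le_of_coeff_ne_zero {x : HahnSeries (ℤ ×ₗ ℤ) k} {g : ℤ ×ₗ ℤ} (h : x.coeff g ≠ 0) :
    fstVal k x ≤ lexFst g :=
  monotone_withTopMap_lexFst (addVal_le_of_coeff_ne_zero h)

theorem fstVal_nonneg {x : HahnSeries (ℤ ×ₗ ℤ) k} (h : 0 ≤ addVal _ k x) : 0 ≤ fstVal k x :=
  monotone_withTopMap_lexFst h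

theorem fstVal_eq_zero {x : HahnSeries (ℤ ×ₗ ℤ) k} (h : addVal _ k x = 0) : fstVal k x = 0 := by
  rw [fstVal_apply, h, map_zero]

theorem addVal_algebraMap {c : k} (hc : c ≠ 0) :
    addVal (ℤ ×ₗ ℤ) k (algebraMap k _ c) = 0 := by
  rw [addVal_apply, algebraMap_apply, C_apply, orderTop_single (by simpa using hc)]
  rfl

theorem addVal_algebraMap_nonneg (c : k) : 0 ≤ addVal (ℤ ×ₗ ℤ) k (algebraMap k _ c) := by
  rcases eq_or_ne c 0 with rfl | hc
  · simp
  · rw [addVal_algebraMap hc]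

theorem addVal_aeval_nonneg {u : HahnSeries (ℤ ×ₗ ℤ) k} (hu : 0 ≤ addVal _ k u)
    (Q : Polynomial k) : 0 ≤ addVal _ k (Polynomial.aeval u Q) := by
  rw [Polynomial.aeval_eq_sum_range]
  refine (addVal _ k).map_le_sum fun i _ => ?_
  rw [Algebra.smul_def, (addVal _ k).map_mul, (addVal _ k).map_pow]
  exact add_nonneg (addVal_algebraMap_nonneg _) (nsmul_nonneg hu _)

theorem addVal_aeval_eq_zero {u : HahnSeries (ℤ ×ₗ ℤ) k} (hu : 0 < addVal _ k u)
    {Q : Polynomial k} (hQ : Q.coeff 0 ≠ 0) : addVal _ k (Polynomial.aeval u Q) = 0 := by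
  rw [← Polynomial.divX_mul_X_add Q, map_add, map_mul, Polynomial.aeval_X, Polynomial.aeval_C,
    AddValuation.map_add_eq_of_lt_right, addVal_algebraMap hQ]
  rw [addVal_algebraMap hQ, AddValuation.map_mul]
  exact hu.trans_le (le_add_of_nonneg_left (addVal_aeval_nonneg hu.le _))

/-- The refining valuation of rank two has residue field `k`, which makes `k` algebraically closed
in the residue field of `fstVal`. An element with negative rank-two value is excluded through the
reversed polynomial; otherwise `c` is the constant coefficient, and `Q`, expanded at `c`, is a power
of the variable times a polynomial whose value at `u - c` is a unit. -/
theorem exists_residue (u : HahnSeries (ℤ ×ₗ ℤ) k) (Q : Polynomial k) (hu : 0 ≤ fstVal k u)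
    (hQ : Q ≠ 0) (h : 0 < fstVal k (Polynomial.aeval u Q)) :
    ∃ c : k, 0 < fstVal k (u - algebraMap k _ c) := by
  rcases hu.eq_or_lt with hu0 | hu0
  swap
  · exact ⟨0, by simpa using hu0⟩
  have hune : u ≠ 0 := by rintro rfl; simp at hu0
  rcases le_or_gt 0 (addVal _ k u) with hw | hw
  · refine ⟨u.coeff 0, ?_⟩
    set c := u.coeff 0
    have hpos : 0 < addVal _ k (u - algebraMap k _ c) := by
      have h1 : 0 ≤ addVal _ k (u - algebraMap k _ c) :=
        (addVal _ k).map_le_sub hw (addVal_algebraMap_nonneg c)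
      refine h1.lt_of_ne fun h2 => ?_
      rw [addVal_apply] at h2
      have h3 := coeff_orderTop_ne (g := 0) h2.symm
      apply h3
      rw [coeff_sub, algebraMap_apply, C_apply, coeff_single_same]
      simp [c]
    set Q' := Q.comp (Polynomial.X + Polynomial.C c) with hQ'
    have hQ'0 : Q' ≠ 0 := by rwa [hQ', Ne, Polynomial.comp_X_add_C_eq_zero_iff]
    have he : Polynomial.aeval (u - algebraMap k _ c) Q' = Polynomial.aeval u Q := by
      rw [hQ', Polynomial.aeval_comp]; simp
    obtain ⟨R, hR⟩ : Polynomial.X ^ Q'.natTrailingDegree ∣ Q' :=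
      Polynomial.X_pow_dvd_iff.2 fun d hd => Polynomial.coeff_eq_zero_of_lt_natTrailingDegree hd
    have hR0 : R.coeff 0 ≠ 0 := by
      have h4 : Q'.coeff Q'.natTrailingDegree ≠ 0 := by
        rwa [Ne, Polynomial.coeff_natTrailingDegree_eq_zero]
      intro h5
      apply h4
      nth_rewrite 1 [hR]
      have := Polynomial.coeff_X_pow_mul R Q'.natTrailingDegree 0
      rw [zero_add] at this
      rw [this, h5]
    rw [← he, hR, map_mul, map_pow, Polynomial.aeval_X, AddValuation.map_mul, AddValuation.map_pow,
      fstVal_eq_zero (addVal_aeval_eq_zero hpos hR0), add_zero] at h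
    refine (fstVal_nonneg hpos.le).lt_of_ne fun h6 => ?_
    rw [← h6, smul_zero] at h
    exact lt_irrefl _ h
  · exfalso
    let := invertibleOfNonzero hune
    have h1 := Polynomial.eval₂_reverse_mul_pow (algebraMap k (HahnSeries (ℤ ×ₗ ℤ) k)) u Q
    have h2 : 0 < addVal _ k (⅟u) := by
      have h3 := (addVal _ k).map_mul u (⅟u)
      rw [mul_invOf_self, AddValuation.map_one] at h3
      by_contra h4
      have h5 : addVal _ k u + addVal _ k (⅟u) < 0 :=
        lt_of_le_of_lt (add_le_of_nonpos_right (not_lt.1 h4)) hw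
      exact h5.ne h3.symm
    rw [Polynomial.aeval_def, ← h1, AddValuation.map_mul, AddValuation.map_pow, ← hu0, smul_zero,
        add_zero,
      ← Polynomial.aeval_def, fstVal_eq_zero (addVal_aeval_eq_zero h2 _)] at h
    · exact lt_irrefl _ h
    · rw [Polynomial.coeff_zero_reverse]; simpa using hQ

theorem isLogValuation_fstVal (k : Type*) [Field k] :
    IsLogValuation (fstVal k) (eulerDerivation k lexFst) (eulerDerivation k lexSnd) where
  le_algebraMap c := fstVal_nonneg (addVal_algebraMap_nonneg c)
  le_left x := monotone_withTopMap_lexFst (addVal_le_eulerDerivation _ x)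
  le_right x := monotone_withTopMap_lexFst (addVal_le_eulerDerivation _ x)
  exists_residue := exists_residue

/-- The exponent of a monomial in the expansion at infinity. -/
def lexExp (i j : ℕ) : ℤ ×ₗ ℤ := toLex (-(i + j : ℤ), -(j : ℤ))

theorem aeval_lexExp (p : MvPolynomial (Fin 2) k) :
    aeval (R := k) ![single (lexExp 1 0) (1 : k), single (lexExp 0 1) 1] p =
      ∑ m ∈ p.support, single (lexExp (m 0) (m 1)) (MvPolynomial.coeff m p) := by
  rw [aeval_fin_two_eq_sum]
  refine Finset.sum_congr rfl fun m _ => ?_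
  rw [single_pow, single_pow, single_mul_single, algebraMap_apply, C_apply, single_mul_single]
  simp only [one_pow, mul_one, zero_add, Algebra.algebraMap_self, RingHom.id_apply]
  congr 2
  apply ofLex.injective
  apply Prod.ext <;> simp [lexExp, ofLex_add]
  ring

/-- The second lexicographic coordinate separates monomials of equal degree, so the top-degree terms
cannot cancel. -/
theorem fstVal_aeval_lexExp {p : MvPolynomial (Fin 2) k} (hp : p ≠ 0) :
    fstVal k (aeval ![single (lexExp 1 0) (1 : k), single (lexExp 0 1) 1] p) =
      (-p.totalDegree : ℤ) := by
  rw [aeval_lexExp]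
  have hinj {m m' : Fin 2 →₀ ℕ} (h : lexExp (m 0) (m 1) = lexExp (m' 0) (m' 1)) : m = m' := by
    have h' := congrArg ofLex h
    simp only [lexExp, ofLex_toLex, Prod.mk.injEq] at h'
    ext i
    fin_cases i <;> simp <;> omega
  apply le_antisymm
  · obtain ⟨m, hm, hmax⟩ := p.support.exists_max_image (fun m => m 0 + m 1) (support_nonempty.2 hp)
    have h1 : (∑ m ∈ p.support, single (lexExp (m 0) (m 1)) (MvPolynomial.coeff m p)).coeff
        (lexExp (m 0) (m 1)) = MvPolynomial.coeff m p := by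
      rw [coeff_sum, Finset.sum_eq_single m]
      · rw [coeff_single_same]
      · intro m' _ hne
        rw [coeff_single_of_ne]
        exact fun h => hne (hinj h).symm
      · exact fun h => absurd hm h
    have h2 := fstVal_le_of_coeff_ne_zero (by rw [h1]; exact mem_support_iff.1 hm)
    refine h2.trans ?_
    have h3 : p.totalDegree ≤ m 0 + m 1 := by
      refine Finset.sup_le fun m' hm' => ?_
      rw [Finsupp.sum_fintype _ _ (by simp), Fin.sum_univ_two]
      exact hmax m' hm'
    change (((-(m 0 + m 1 : ℤ)) : ℤ) : WithTop ℤ) ≤ _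
    norm_cast
    omega
  · refine (fstVal k).map_le_sum fun m hm => ?_
    have h1 : (lexExp (m 0) (m 1) : WithTop (ℤ ×ₗ ℤ)) ≤ addVal _ k (single (lexExp (m 0) (m 1))
        (MvPolynomial.coeff m p)) := by
      rw [addVal_apply]; exact orderTop_single_le
    refine le_trans ?_ (monotone_withTopMap_lexFst h1)
    have h3 : m 0 + m 1 ≤ p.totalDegree := by
      have := le_totalDegree hm
      rwa [Finsupp.sum_fintype _ _ (by simp), Fin.sum_univ_two] at this
    change _ ≤ (((-(m 0 + m 1 : ℤ)) : ℤ) : WithTop ℤ)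
    norm_cast
    omega

theorem derivBracket_lexExp :
    derivBracket (eulerDerivation k lexFst) (eulerDerivation k lexSnd)
      (single (lexExp 1 0) (1 : k)) (single (lexExp 0 1) 1) =
    aeval ![single (lexExp 1 0) (1 : k), single (lexExp 0 1) 1] (X 0 * X 1 : MvPolynomial (Fin 2)
        k) := by
  simp only [derivBracket, eulerDerivation_single]
  have e1 : lexFst (lexExp 1 0) = -1 := rfl
  have e2 : lexSnd (lexExp 1 0) = 0 := rfl
  have e4 : lexSnd (lexExp 0 1) = -1 := rfl
  rw [e1, e2, e4]
  simp

end HahnSeries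

open HahnSeries in
/-- The reduction step of the Jung–van der Kulk theorem, over an arbitrary field. -/
theorem MvPolynomial.totalDegree_eq_one_or_exists_lt (f P : Fin 2 → MvPolynomial (Fin 2) k)
    (hP : ∀ i, aeval f (P i) = X i)
    (hjac : pderiv 0 (f 0) * pderiv 1 (f 1) - pderiv 1 (f 0) * pderiv 0 (f 1) = 1) :
    ((f 0).totalDegree = 1 ∧ (f 1).totalDegree = 1) ∨
      (∃ (c : k) (q : ℕ), (f 1 - C c * f 0 ^ q).totalDegree < (f 1).totalDegree) ∨
      (∃ (c : k) (q : ℕ), (f 0 - C c * f 1 ^ q).totalDegree < (f 0).totalDegree) := by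
  by_contra hcon
  simp only [not_or, not_exists, not_lt] at hcon
  obtain ⟨hdeg, h1, h2⟩ := hcon
  have hpos : ∀ i, 0 < (f i).totalDegree := by
    intro i
    refine Nat.pos_of_ne_zero fun h0 => ?_
    rw [totalDegree_eq_zero_iff_eq_C] at h0
    have h3 : ∀ j, pderiv j (f i) = 0 := fun j => by rw [h0, pderiv_C]
    have h4 := h3 0
    have h5 := h3 1
    fin_cases i
    · change pderiv 0 (f 0) = 0 at h4
      change pderiv 1 (f 0) = 0 at h5
      rw [h4, h5, zero_mul, zero_mul, sub_zero] at hjac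
      exact zero_ne_one hjac
    · change pderiv 0 (f 1) = 0 at h4
      change pderiv 1 (f 1) = 0 at h5
      rw [h4, h5, mul_zero, mul_zero, sub_zero] at hjac
      exact zero_ne_one hjac
  have hne : ∀ i, f i ≠ 0 := fun i h => by have := hpos i; simp [h] at this
  set φ : MvPolynomial (Fin 2) k →ₐ[k] HahnSeries (ℤ ×ₗ ℤ) k :=
    aeval ![single (lexExp 1 0) (1 : k), single (lexExp 0 1) 1] with hφ
  set D₁ := eulerDerivation k lexFst
  set D₂ := eulerDerivation k lexSnd
  have hv {p : MvPolynomial (Fin 2) k} (hp : p ≠ 0) : fstVal k (φ p) = (-p.totalDegree : ℤ) :=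
    fstVal_aeval_lexExp hp
  have hbX : derivBracket D₁ D₂ (single (lexExp 1 0) (1 : k)) (single (lexExp 0 1) 1) = φ (X 0 * X 1) :=
    derivBracket_lexExp
  have hXX : (X 0 * X 1 : MvPolynomial (Fin 2) k).totalDegree = 2 := by
    rw [totalDegree_mul_of_isDomain (X_ne_zero _) (X_ne_zero _), totalDegree_X, totalDegree_X]
  have hXX0 : (X 0 * X 1 : MvPolynomial (Fin 2) k) ≠ 0 := mul_ne_zero (X_ne_zero _) (X_ne_zero _)
  have hb : fstVal k (derivBracket D₁ D₂ (φ (f 0)) (φ (f 1))) = (-2 : ℤ) := by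
    rw [hφ, derivBracket_aeval, hjac, map_one, one_mul]
    simp only [Matrix.cons_val_zero, Matrix.cons_val_one]
    rw [hbX, hv hXX0, hXX]; rfl
  have hlt {p q : MvPolynomial (Fin 2) k} (hp0 : 0 < p.totalDegree)
      (h : fstVal k (φ p) < fstVal k (φ q)) : q.totalDegree < p.totalDegree := by
    have hp : p ≠ 0 := by rintro rfl; simp at hp0
    rcases eq_or_ne q 0 with rfl | hq
    · simpa using hp0
    · rw [hv hp, hv hq] at h
      norm_cast at h
      omega
  have hsub (p q : MvPolynomial (Fin 2) k) (c : k) (n : ℕ) :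
      φ p - algebraMap k _ c * φ q ^ n = φ (p - C c * q ^ n) := by
    rw [map_sub, map_mul, map_pow, ← algebraMap_eq, AlgHom.commutes]
  have hφP : ∀ i, aeval ![φ (f 0), φ (f 1)] (P i) = φ (X i) := by
    intro i
    rw [← hP i, comp_aeval_apply]
    congr 2
    ext j; fin_cases j <;> rfl
  -- `P i (f) = X i` has value `-1`, which rules out the alternative `≤ -2`.
  have key (i : Fin 2) (m : Fin 2 →₀ ℕ) (hm : coeff m (P i) ≠ 0) :
      (f 0).totalDegree * m 0 + (f 1).totalDegree * m 1 ≤ 1 := by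
    have h3 := (isLogValuation_fstVal k).aeval_le_of_forall_not_lt (φ (f 0)) (φ (f 1)) _ _ (hpos 0)
        (hpos 1)
      (hv (hne 0)) (hv (hne 1)) hb
      (fun c q h => (h1 c q).not_gt (hlt (hpos 1) (by rw [← hsub]; exact h)))
      (fun c q h => (h2 c q).not_gt (hlt (hpos 0) (by rw [← hsub]; exact h))) (P i) m hm
    rw [hφP, hv (X_ne_zero i), totalDegree_X] at h3
    rcases h3 with h3 | h3
    · have h3' := WithTop.coe_le_coe.1 h3
      zify
      push_cast at h3'
      linarith
    · have h3' := WithTop.coe_le_coe.1 h3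
      norm_num at h3'
  -- A vanishing column would make the Jacobian of `P` zero, and with it the bracket of `X 0` and `X
  -- 1`, which is the image of `X 0 * X 1`.
  have hcontra (j : Fin 2) (h : ∀ i, pderiv j (P i) = 0) : False := by
    have h3 := derivBracket_aeval D₁ D₂ ![φ (f 0), φ (f 1)] (P 0) (P 1)
    have h4 : pderiv 0 (P 0) * pderiv 1 (P 1) - pderiv 1 (P 0) * pderiv 0 (P 1) = 0 := by
      fin_cases j <;> simp_all
    rw [h4, map_zero, zero_mul, hφP, hφP] at h3
    have h5 : φ (X 0 * X 1) = 0 := by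
      rw [← hbX, ← h3]
      simp [hφ]
    have h6 := hv hXX0
    rw [h5, AddValuation.map_zero] at h6
    exact WithTop.top_ne_coe h6
  have hone (j : Fin 2) (hj : ∀ i m, coeff m (P i) ≠ 0 → m j = 0) : False := by
    refine hcontra j fun i => pderiv_eq_zero_of_notMem_vars ?_
    rw [mem_vars_iff_mem_support]
    rintro ⟨m, hm, hmj⟩
    exact Finsupp.mem_support_iff.1 hmj (hj i m (mem_support_iff.1 hm))
  apply hdeg
  constructor
  -- If `f 0` has degree at least `2`, the bound `key` keeps `X 0` out of both components of `P`.
  · by_contra h3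
    refine hone 0 fun i m hm => ?_
    have := key i m hm
    have := hpos 0
    by_contra h4
    have : 2 * 1 ≤ (f 0).totalDegree * m 0 := Nat.mul_le_mul (by omega) (by omega)
    omega
  · by_contra h3
    refine hone 1 fun i m hm => ?_
    have := key i m hm
    have := hpos 1
    by_contra h4
    have : 2 * 1 ≤ (f 1).totalDegree * m 1 := Nat.mul_le_mul (by omega) (by omega)
    omega

end

/-! ### Affine automorphisms and generators of the group -/

section

variable {k : Type*} [Field k]

namespace SAut

/-- The components of an automorphism. -/
noncomputable def coord (f : SAut 2 k) (i : Fin 2) : MvPolynomial (Fin 2) k := f.val.val.coord i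

theorem ext_coord {f g : SAut 2 k} (h : ∀ i, coord f i = coord g i) : f = g :=
  Subtype.ext (Units.ext (AffineEnd.ext (funext h)))

theorem coord_mul (f g : SAut 2 k) (i : Fin 2) : coord (f * g) i = aeval (coord g) (coord f i) := rfl

theorem coord_one (i : Fin 2) : coord (1 : SAut 2 k) i = X i := rfl

theorem coord_shear_zero (s : Polynomial k) : coord (shear s) 0 = X 0 := rfl

theorem coord_shear_one (s : Polynomial k) :
    coord (shear s) 1 = X 1 + Polynomial.aeval (X 0) s := rfl

theorem jacobian_coord (f : SAut 2 k) :
    pderiv 0 (coord f 0) * pderiv 1 (coord f 1) - pderiv 1 (coord f 0) * pderiv 0 (coord f 1) = 1 := by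
  have h : f.val.val.jac = 1 := f.property
  rw [AffineEnd.jac, Matrix.det_fin_two] at h
  exact h

theorem aeval_coord_inv (f : SAut 2 k) (i : Fin 2) : aeval (coord f) (coord f⁻¹ i) = X i := by
  rw [← coord_mul, inv_mul_cancel, coord_one]

end SAut

/-- The affine endomorphism `x ↦ M x + v`. -/
noncomputable def affEnd (M : Matrix (Fin 2) (Fin 2) k) (v : Fin 2 → k) : AffineEnd 2 k :=
  ⟨fun i => C (M i 0) * X 0 + C (M i 1) * X 1 + C (v i)⟩

theorem affEnd_mul (M N : Matrix (Fin 2) (Fin 2) k) (v w : Fin 2 → k) :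
    affEnd M v * affEnd N w = affEnd (M * N) (fun i => M i 0 * w 0 + M i 1 * w 1 + v i) := by
  refine AffineEnd.ext (funext fun i => ?_)
  simp only [AffineEnd.mul_coord, affEnd, map_add, map_mul, bind₁_C_right, bind₁_X_right,
    Matrix.mul_apply, Fin.sum_univ_two]
  ring

theorem affEnd_one : affEnd (1 : Matrix (Fin 2) (Fin 2) k) 0 = 1 := by
  refine AffineEnd.ext (funext fun i => ?_)
  fin_cases i <;> simp [affEnd, AffineEnd.one_coord]

theorem translation_mul_linear_eq_affEnd (v : Fin 2 → k) (M : Matrix.GeneralLinearGroup (Fin 2) k) :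
    (translationAut v * linearAut M).val = affEnd M.val v := by
  refine AffineEnd.ext (funext fun i => ?_)
  change bind₁ _ (X i + C (v i)) = _
  simp [linearAut, linearEnd, affEnd, Fin.sum_univ_two]

theorem translationAut_eq_affEnd (v : Fin 2 → k) : (translationAut v).val = affEnd 1 v := by
  refine AffineEnd.ext (funext fun i => ?_)
  fin_cases i <;> simp [affEnd, translationAut]

theorem linearAut_eq_affEnd (M : Matrix.GeneralLinearGroup (Fin 2) k) :
    (linearAut M).val = affEnd M.val 0 := by
  refine AffineEnd.ext (funext fun i => ?_)
  simp [linearAut, linearEnd, affEnd, Fin.sum_univ_two]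

theorem jac_affEnd (M : Matrix (Fin 2) (Fin 2) k) (v : Fin 2 → k) :
    (affEnd M v).jac = C M.det := by
  simp [AffineEnd.jac, AffineEnd.derivative, affEnd, Matrix.det_fin_two, pderiv_X, Pi.single_apply]

theorem affEnd_mul_eq_one {M : Matrix (Fin 2) (Fin 2) k} (hM : M.det = 1) (v : Fin 2 → k) :
    affEnd M v * affEnd M.adjugate (fun i => -(M.adjugate i 0 * v 0 + M.adjugate i 1 * v 1)) = 1 := by
  have h1 : M * M.adjugate = 1 := by rw [Matrix.mul_adjugate, hM, one_smul]
  rw [affEnd_mul, h1, ← affEnd_one]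
  congr 1
  funext i
  have h2 (i j : Fin 2) := congrFun (congrFun h1 i) j
  simp only [Matrix.mul_apply, Fin.sum_univ_two] at h2
  fin_cases i
  · have a := h2 0 0
    have b := h2 0 1
    simp at a b ⊢
    linear_combination - v 0 * a - v 1 * b
  · have a := h2 1 0
    have b := h2 1 1
    simp at a b ⊢
    linear_combination - v 0 * a - v 1 * b

theorem adjugate_affEnd_mul_eq_one {M : Matrix (Fin 2) (Fin 2) k} (hM : M.det = 1) (v : Fin 2 → k) :
    affEnd M.adjugate (fun i => -(M.adjugate i 0 * v 0 + M.adjugate i 1 * v 1)) * affEnd M v = 1 := by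
  have h1 : M.adjugate * M = 1 := by rw [Matrix.adjugate_mul, hM, one_smul]
  rw [affEnd_mul, h1, ← affEnd_one]
  congr 1
  funext i
  simp

namespace SAut

/-- The affine automorphism `x ↦ M x + v`, for `M` of determinant one. -/
noncomputable def aff (M : Matrix (Fin 2) (Fin 2) k) (hM : M.det = 1) (v : Fin 2 → k) : SAut 2 k :=
  ⟨⟨affEnd M v, _, affEnd_mul_eq_one hM v, adjugate_affEnd_mul_eq_one hM v⟩, by
    change (affEnd M v).jac = 1
    rw [jac_affEnd, hM, map_one]⟩

theorem coord_aff (M : Matrix (Fin 2) (Fin 2) k) (hM : M.det = 1) (v : Fin 2 → k) (i : Fin 2) :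
    coord (aff M hM v) i = C (M i 0) * X 0 + C (M i 1) * X 1 + C (v i) := rfl

theorem aff_mul (M N : Matrix (Fin 2) (Fin 2) k) (hM : M.det = 1) (hN : N.det = 1) (v w : Fin 2 → k) :
    aff M hM v * aff N hN w = aff (M * N) (by rw [Matrix.det_mul, hM, hN, one_mul])
      (fun i => M i 0 * w 0 + M i 1 * w 1 + v i) :=
  Subtype.ext (Units.ext (affEnd_mul M N v w))

variable (k) in
/-- The subgroup of affine automorphisms. -/
def affSubgroup : Subgroup (SAut 2 k) where
  carrier := {f | ∃ M hM v, f = aff M hM v}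
  one_mem' := ⟨1, Matrix.det_one, 0, Subtype.ext (Units.ext affEnd_one.symm)⟩
  mul_mem' := by
    rintro _ _ ⟨M, hM, v, rfl⟩ ⟨N, hN, w, rfl⟩
    exact ⟨_, _, _, aff_mul M N hM hN v w⟩
  inv_mem' := by
    rintro _ ⟨M, hM, v, rfl⟩
    refine ⟨M.adjugate, by rw [Matrix.det_adjugate, hM, one_pow],
      fun i => -(M.adjugate i 0 * v 0 + M.adjugate i 1 * v 1), ?_⟩
    rw [inv_eq_iff_mul_eq_one]
    exact Subtype.ext (Units.ext (affEnd_mul_eq_one hM v))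

theorem mem_affSubgroup_of_eq_affEnd {f : SAut 2 k} {M : Matrix (Fin 2) (Fin 2) k} {v : Fin 2 → k}
    (h : f.val.val = affEnd M v) : ∃ hM : M.det = 1, f = aff M hM v := by
  have h1 : f.val.val.jac = 1 := f.property
  rw [h, jac_affEnd, ← map_one C] at h1
  exact ⟨C_injective _ _ h1, Subtype.ext (Units.ext h)⟩

theorem exists_eq_aff_of_mem_saffSet {f : SAut 2 k} (h : f ∈ saffSet 2 k) :
    f ∈ affSubgroup k := by
  obtain ⟨v, M, hf⟩ := h
  obtain ⟨hM, e⟩ := mem_affSubgroup_of_eq_affEnd (f := f) (M := M.val) (v := v)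
    (by rw [hf, translation_mul_linear_eq_affEnd])
  exact ⟨_, hM, _, e⟩

theorem exists_eq_aff_of_mem_translationSet {f : SAut 2 k} (h : f ∈ translationSet 2 k) :
    ∃ v, f = aff 1 Matrix.det_one v := by
  obtain ⟨v, hf⟩ := h
  obtain ⟨hM, e⟩ := mem_affSubgroup_of_eq_affEnd (f := f) (M := 1) (v := v)
    (by rw [hf, translationAut_eq_affEnd])
  exact ⟨v, e⟩

theorem exists_eq_aff_of_mem_slSet {f : SAut 2 k} (h : f ∈ slSet 2 k) :
    ∃ M hM, f = aff M hM 0 := by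
  obtain ⟨M, hM, hf⟩ := h
  obtain ⟨hM, e⟩ := mem_affSubgroup_of_eq_affEnd (f := f) (M := M.val) (v := 0)
    (by rw [hf, linearAut_eq_affEnd])
  exact ⟨_, hM, e⟩

theorem aff_mem_translationSet (v : Fin 2 → k) : aff 1 Matrix.det_one v ∈ translationSet 2 k :=
  ⟨v, Units.ext (translationAut_eq_affEnd v).symm⟩

theorem aff_mem_slSet (M : Matrix (Fin 2) (Fin 2) k) (hM : M.det = 1) :
    aff M hM 0 ∈ slSet 2 k := by
  let N : Matrix.GeneralLinearGroup (Fin 2) k :=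
    ⟨M, M.adjugate, by rw [Matrix.mul_adjugate, hM, one_smul],
      by rw [Matrix.adjugate_mul, hM, one_smul]⟩
  exact ⟨N, hM, Units.ext (linearAut_eq_affEnd N).symm⟩

theorem aff_eq_translation_mul_linear (M : Matrix (Fin 2) (Fin 2) k) (hM : M.det = 1) (v : Fin 2 → k) :
    aff M hM v = aff 1 Matrix.det_one v * aff M hM 0 := by
  rw [aff_mul]
  congr 1
  · rw [one_mul]
  · funext i; simp

end SAut

theorem Finsupp.ext_fin_two {m n : Fin 2 →₀ ℕ} (h0 : m 0 = n 0) (h1 : m 1 = n 1) : m = n :=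
  Finsupp.ext (Fin.forall_fin_two.2 ⟨h0, h1⟩)

theorem MvPolynomial.eq_of_totalDegree_le_one {p : MvPolynomial (Fin 2) k} (hp : p.totalDegree ≤ 1) :
    p = C (coeff (Finsupp.single 0 1) p) * X 0 + C (coeff (Finsupp.single 1 1) p) * X 1 +
      C (coeff 0 p) := by
  have h01 : (Finsupp.single (0 : Fin 2) 1 : Fin 2 →₀ ℕ) ≠ Finsupp.single 1 1 := by
    intro h; have := DFunLike.congr_fun h 0; simp at this
  have h0 (i : Fin 2) : (0 : Fin 2 →₀ ℕ) ≠ Finsupp.single i 1 := by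
    intro h; have := DFunLike.congr_fun h i; simp at this
  ext m
  simp only [coeff_add, coeff_C_mul, coeff_X, coeff_C]
  by_cases hm : m 0 + m 1 ≤ 1
  · have h : (m 0 = 0 ∧ m 1 = 0) ∨ (m 0 = 1 ∧ m 1 = 0) ∨ (m 0 = 0 ∧ m 1 = 1) := by omega
    rcases h with ⟨a, b⟩ | ⟨a, b⟩ | ⟨a, b⟩
    · obtain rfl : m = 0 := Finsupp.ext_fin_two (by simp [a]) (by simp [b])
      simp only [if_neg (h0 _).symm, if_true, mul_zero, zero_add]
    · obtain rfl : m = Finsupp.single 0 1 := Finsupp.ext_fin_two (by simp [a]) (by simp [b])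
      simp only [if_neg h01.symm, if_neg (h0 _), if_true, mul_one, mul_zero, add_zero]
    · obtain rfl : m = Finsupp.single 1 1 := Finsupp.ext_fin_two (by simp [a]) (by simp [b])
      simp only [if_neg h01, if_neg (h0 _), if_true, mul_one, mul_zero, add_zero, zero_add]
  · have h1 : coeff m p = 0 := by
      apply coeff_eq_zero_of_totalDegree_lt
      have : ∑ i ∈ m.support, m i = m 0 + m 1 := by
        have := Finsupp.sum_fintype m (fun _ e => e) (by simp)
        rw [Fin.sum_univ_two] at this
        exact this
      omega
    rw [h1]
    have h2 : Finsupp.single 0 1 ≠ m := by rintro rfl; simp at hm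
    have h3 : Finsupp.single 1 1 ≠ m := by rintro rfl; simp at hm
    have h4 : 0 ≠ m := by rintro rfl; simp at hm
    simp only [if_neg h2, if_neg h3, if_neg h4, mul_zero, add_zero]

namespace SAut

/-- The automorphism `(x₂, -x₁)`. -/
noncomputable def weyl (k : Type*) [Field k] : SAut 2 k :=
  aff !![0, 1; -1, 0] (by simp [Matrix.det_fin_two]) 0

theorem coord_weyl_zero : coord (weyl k) 0 = X 1 := by simp [weyl, coord_aff]

theorem coord_weyl_one : coord (weyl k) 1 = - X 0 := by simp [weyl, coord_aff]

/-- The automorphism `(x₁ - s(x₂), x₂)`. -/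
noncomputable def lowerShear (s : Polynomial k) : SAut 2 k := (weyl k)⁻¹ * shear s * weyl k

theorem weyl_inv : (weyl k)⁻¹ = aff !![0, -1; 1, 0] (by simp [Matrix.det_fin_two]) 0 := by
  rw [inv_eq_iff_mul_eq_one, weyl, aff_mul]
  refine Subtype.ext (Units.ext ?_)
  change affEnd _ _ = 1
  rw [← affEnd_one]
  congr 1
  · ext i j; fin_cases i <;> fin_cases j <;> simp [Matrix.mul_apply]
  · funext i; simp

theorem coord_lowerShear_zero (s : Polynomial k) :
    coord (lowerShear s) 0 = X 0 - Polynomial.aeval (X 1) s := by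
  rw [lowerShear, coord_mul, coord_mul, weyl_inv, coord_aff]
  simp [coord_shear_one, coord_weyl_zero, coord_weyl_one, ← Polynomial.aeval_algHom_apply]
  ring

theorem coord_lowerShear_one (s : Polynomial k) : coord (lowerShear s) 1 = X 1 := by
  rw [lowerShear, coord_mul, coord_mul, weyl_inv, coord_aff]
  simp [coord_shear_zero, coord_weyl_zero]

theorem mem_affSubgroup_of_totalDegree_le {f : SAut 2 k} (h : ∀ i, (coord f i).totalDegree ≤ 1) :
    f ∈ affSubgroup k := by
  obtain ⟨hM, e⟩ := mem_affSubgroup_of_eq_affEnd (f := f)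
    (M := Matrix.of fun i j => coeff (Finsupp.single j 1) (coord f i))
    (v := fun i => coeff 0 (coord f i))
    (AffineEnd.ext (funext fun i => eq_of_totalDegree_le_one (h i)))
  exact ⟨_, hM, _, e⟩

/-- The theorem of Jung and van der Kulk: the group is generated by the affine automorphisms
and the elementary ones. -/
theorem eq_top_of_affSubgroup_le {H : Subgroup (SAut 2 k)} (hA : affSubgroup k ≤ H)
    (hs : ∀ s, shear s ∈ H) : H = ⊤ := by
  have hw : weyl k ∈ H := hA ⟨_, _, _, rfl⟩
  have hl : ∀ s, lowerShear s ∈ H := fun s => H.mul_mem (H.mul_mem (H.inv_mem hw) (hs s)) hw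
  refine (Subgroup.eq_top_iff' H).2 fun f => ?_
  induction hN : (coord f 0).totalDegree + (coord f 1).totalDegree using Nat.strong_induction_on
    generalizing f with
  | _ N ih =>
  rcases totalDegree_eq_one_or_exists_lt (coord f) (coord f⁻¹) (aeval_coord_inv f)
      (jacobian_coord f) with
    ⟨h0, h1⟩ | ⟨c, q, h⟩ | ⟨c, q, h⟩
  · exact hA (mem_affSubgroup_of_totalDegree_le fun i => by fin_cases i <;> simp [h0, h1])
  · set g := shear (-(Polynomial.C c * Polynomial.X ^ q)) * f with hg
    have e0 : coord g 0 = coord f 0 := by rw [hg, coord_mul, coord_shear_zero, aeval_X]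
    have e1 : coord g 1 = coord f 1 - C c * coord f 0 ^ q := by
      rw [hg, coord_mul, coord_shear_one, map_add, aeval_X, ← Polynomial.aeval_algHom_apply, aeval_X]
      simp [sub_eq_add_neg, algebraMap_eq]
    have hgH := ih _ (by rw [← hN, e0, e1]; omega) g rfl
    rw [hg] at hgH
    exact (H.mul_mem_cancel_left (hs _)).1 hgH
  · set g := lowerShear (Polynomial.C c * Polynomial.X ^ q) * f with hg
    have e1 : coord g 1 = coord f 1 := by rw [hg, coord_mul, coord_lowerShear_one, aeval_X]
    have e0 : coord g 0 = coord f 0 - C c * coord f 1 ^ q := by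
      rw [hg, coord_mul, coord_lowerShear_zero, map_sub, aeval_X, ← Polynomial.aeval_algHom_apply,
          aeval_X]
      simp [algebraMap_eq]
    have hgH := ih _ (by rw [← hN, e0, e1]; omega) g rfl
    rw [hg] at hgH
    exact (H.mul_mem_cancel_left (hl _)).1 hgH

theorem aff_lower_eq_shear (c d : k) :
    aff !![1, 0; c, 1] (by simp [Matrix.det_fin_two]) ![0, d] =
      shear (Polynomial.C c * Polynomial.X + Polynomial.C d) := by
  refine ext_coord fun i => ?_
  fin_cases i <;> simp [coord_aff, coord_shear_zero, coord_shear_one, algebraMap_eq]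
  ring

theorem aff_upper_eq_lowerShear (c d : k) :
    aff !![1, c; 0, 1] (by simp [Matrix.det_fin_two]) ![d, 0] =
      lowerShear (-(Polynomial.C c * Polynomial.X + Polynomial.C d)) := by
  refine ext_coord fun i => ?_
  fin_cases i <;> simp [coord_aff, coord_lowerShear_zero, coord_lowerShear_one, algebraMap_eq]
  ring

theorem aff_congr {M N : Matrix (Fin 2) (Fin 2) k} {hM : M.det = 1} {hN : N.det = 1}
    {v w : Fin 2 → k} (h : M = N) (h' : v = w) : aff M hM v = aff N hN w := by
  subst h h'; rfl

/-- The group is generated by the elementary automorphisms. -/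
theorem eq_top_of_shear_mem {H : Subgroup (SAut 2 k)} (hs : ∀ s, shear s ∈ H)
    (hl : ∀ s, lowerShear s ∈ H) : H = ⊤ := by
  have hlow (c : k) : aff !![1, 0; c, 1] (by simp [Matrix.det_fin_two]) 0 ∈ H := by
    have := hs (Polynomial.C c * Polynomial.X + Polynomial.C 0)
    rw [← aff_lower_eq_shear] at this
    convert this using 2
    ext i; fin_cases i <;> rfl
  have hup (c : k) : aff !![1, c; 0, 1] (by simp [Matrix.det_fin_two]) 0 ∈ H := by
    have := hl (-(Polynomial.C c * Polynomial.X + Polynomial.C 0))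
    rw [← aff_upper_eq_lowerShear] at this
    convert this using 2
    ext i; fin_cases i <;> rfl
  have htr (v : Fin 2 → k) : aff 1 Matrix.det_one v ∈ H := by
    have h1 := hs (Polynomial.C 0 * Polynomial.X + Polynomial.C (v 1))
    have h2 := hl (-(Polynomial.C 0 * Polynomial.X + Polynomial.C (v 0)))
    rw [← aff_lower_eq_shear] at h1
    rw [← aff_upper_eq_lowerShear] at h2
    have h3 := H.mul_mem h1 h2
    rw [aff_mul] at h3
    convert h3 using 1
    refine aff_congr ?_ ?_
    · ext i j; fin_cases i <;> fin_cases j <;> simp [Matrix.mul_apply]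
    · ext i; fin_cases i <;> simp
  -- A matrix of determinant one with nonzero lower left entry is a product upper · lower · upper of
  -- unipotent matrices.
  have hne (M : Matrix (Fin 2) (Fin 2) k) (hM : M.det = 1) (h0 : M 1 0 ≠ 0) : aff M hM 0 ∈ H := by
    have h3 := H.mul_mem (H.mul_mem (hup ((M 0 0 - 1) / M 1 0)) (hlow (M 1 0))) (hup ((M 1 1 - 1)
        / M 1 0))
    rw [aff_mul, aff_mul] at h3
    convert h3 using 1
    refine aff_congr ?_ ?_
    · rw [Matrix.det_fin_two] at hM
      ext i j
      fin_cases i <;> fin_cases j <;> simp [Matrix.mul_apply] <;> field_simp <;> 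
        first | ring1 | linear_combination hM | linear_combination -hM
    · ext i; fin_cases i <;> simp
  refine eq_top_of_affSubgroup_le ?_ hs
  rintro _ ⟨M, hM, v, rfl⟩
  rw [aff_eq_translation_mul_linear]
  refine H.mul_mem (htr v) ?_
  by_cases h0 : M 1 0 = 0
  · have h00 : M 0 0 ≠ 0 := by
      intro h; rw [Matrix.det_fin_two, h, h0] at hM; simp at hM
    -- Adding the first row to the second makes the lower left entry nonzero.
    rw [← H.mul_mem_cancel_left (hlow 1), aff_mul]
    have := hne (!![1, 0; 1, 1] * M) (by rw [Matrix.det_mul, hM]; simp [Matrix.det_fin_two])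
      (by simpa [Matrix.mul_apply, h0] using h00)
    convert this using 1
    refine aff_congr rfl ?_
    ext i; fin_cases i <;> simp
  · exact hne M hM h0

end SAut

end

/-! ### Triangular automorphisms and the amalgam structure -/

section

variable {k : Type*} [Field k]

theorem MvPolynomial.totalDegree_aeval_le (p : MvPolynomial (Fin 2) k) (s : Polynomial k) :
    (Polynomial.aeval p s).totalDegree ≤ s.natDegree * p.totalDegree := by
  rw [Polynomial.aeval_eq_sum_range]
  refine totalDegree_finsetSum_le fun i hi => ?_
  refine (totalDegree_smul_le _ _).trans ((totalDegree_pow _ _).trans ?_)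
  exact Nat.mul_le_mul_right _ (by simpa [Nat.lt_succ_iff] using hi)

theorem MvPolynomial.totalDegree_aeval (p : MvPolynomial (Fin 2) k) (hp : 0 < p.totalDegree)
    (s : Polynomial k) : (Polynomial.aeval p s).totalDegree = s.natDegree * p.totalDegree := by
  rcases Nat.eq_zero_or_pos s.natDegree with h0 | h0
  · have := totalDegree_aeval_le p s
    rw [h0] at this ⊢
    omega
  have hs : s ≠ 0 := by rintro rfl; simp at h0
  have hp0 : p ≠ 0 := by rintro rfl; simp at hp
  have h1 : (Polynomial.aeval p s.eraseLead).totalDegree < s.natDegree * p.totalDegree := by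
    refine (totalDegree_aeval_le _ _).trans_lt (Nat.mul_lt_mul_of_pos_right ?_ hp)
    have := s.eraseLead_natDegree_le
    omega
  have h2 : (C s.leadingCoeff * p ^ s.natDegree).totalDegree = s.natDegree * p.totalDegree := by
    rw [totalDegree_mul_of_isDomain (by simpa using hs) (pow_ne_zero _ hp0), totalDegree_C, zero_add]
    generalize s.natDegree = n
    induction n with
    | zero => simp
    | succ n ih =>
      rw [pow_succ, totalDegree_mul_of_isDomain (pow_ne_zero _ hp0) hp0, ih, add_one_mul]
  have h3 : Polynomial.aeval p s = C s.leadingCoeff * p ^ s.natDegree +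
      Polynomial.aeval p s.eraseLead := by
    conv_lhs => rw [← s.eraseLead_add_C_mul_X_pow]
    rw [map_add, map_mul, map_pow, Polynomial.aeval_C, Polynomial.aeval_X, algebraMap_eq, add_comm]
  rw [h3, totalDegree_add_eq_left_of_totalDegree_lt (by rw [h2]; exact h1), h2]

/-- The triangular endomorphism `(a x₁ + b, a⁻¹ x₂ + s(x₁))`. -/
noncomputable def triEnd (a b : k) (s : Polynomial k) : AffineEnd 2 k :=
  ⟨![C a * X 0 + C b, C a⁻¹ * X 1 + Polynomial.aeval (X 0) s]⟩

theorem triEnd_mul (a b a' b' : k) (s s' : Polynomial k) :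
    triEnd a b s * triEnd a' b' s' = triEnd (a * a') (a * b' + b)
      (Polynomial.C a⁻¹ * s' + s.comp (Polynomial.C a' * Polynomial.X + Polynomial.C b')) := by
  refine AffineEnd.ext (funext fun i => ?_)
  fin_cases i
  · simp [AffineEnd.mul_coord, triEnd]; ring
  · simp [AffineEnd.mul_coord, triEnd, Polynomial.aeval_comp, ← Polynomial.aeval_algHom_apply,
        algebraMap_eq]
    ring

theorem triEnd_one : triEnd 1 0 0 = (1 : AffineEnd 2 k) := by
  refine AffineEnd.ext (funext fun i => ?_)
  fin_cases i <;> simp [triEnd, AffineEnd.one_coord]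

namespace SAut

variable (k) in
/-- The subgroup of triangular automorphisms `(a x₁ + b, a⁻¹ x₂ + s(x₁))`. -/
def triSubgroup : Subgroup (SAut 2 k) where
  carrier := {f | ∃ (a b : k) (s : Polynomial k), a ≠ 0 ∧ f.val.val = triEnd a b s}
  one_mem' := ⟨1, 0, 0, one_ne_zero, triEnd_one.symm⟩
  mul_mem' := by
    rintro f g ⟨a, b, s, ha, hf⟩ ⟨a', b', s', ha', hg⟩
    have h : (f * g).val.val = f.val.val * g.val.val := rfl
    rw [hf, hg, triEnd_mul] at h
    exact ⟨_, _, _, mul_ne_zero ha ha', h⟩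
  inv_mem' := by
    rintro f ⟨a, b, s, ha, hf⟩
    refine ⟨a⁻¹, -(a⁻¹ * b), -(Polynomial.C a * s.comp (Polynomial.C a⁻¹ * Polynomial.X +
        Polynomial.C (-(a⁻¹ * b)))),
      inv_ne_zero ha, ?_⟩
    change (f.val⁻¹).val = _
    apply Units.inv_eq_of_mul_eq_one_right
    rw [hf, triEnd_mul, ← triEnd_one]
    congr 1
    · exact mul_inv_cancel₀ ha
    · field_simp; ring
    · rw [mul_neg, ← mul_assoc, ← map_mul, inv_mul_cancel₀ ha, map_one, one_mul, neg_add_cancel]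

theorem shear_mem_triSubgroup (s : Polynomial k) : shear s ∈ triSubgroup k := by
  refine ⟨1, 0, s, one_ne_zero, AffineEnd.ext (funext fun i => ?_)⟩
  fin_cases i <;> simp [shear, shearAut, triEnd]

theorem aff_mem_triSubgroup {M : Matrix (Fin 2) (Fin 2) k} (hM : M.det = 1) {v : Fin 2 → k}
    (h : M 0 1 = 0) : aff M hM v ∈ triSubgroup k := by
  rw [Matrix.det_fin_two, h, zero_mul, sub_zero] at hM
  refine ⟨M 0 0, v 0, Polynomial.C (M 1 0) * Polynomial.X + Polynomial.C (v 1),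
    left_ne_zero_of_mul_eq_one hM, AffineEnd.ext (funext fun i => ?_)⟩
  fin_cases i
  · simp [aff, affEnd, triEnd, h]
  · simp [aff, affEnd, triEnd, algebraMap_eq, eq_inv_of_mul_eq_one_right hM]
    ring

theorem totalDegree_coord_le_of_mem_affSubgroup {f : SAut 2 k} (hf : f ∈ affSubgroup k) (i : Fin 2) :
    (coord f i).totalDegree ≤ 1 := by
  obtain ⟨M, hM, v, rfl⟩ := hf
  rw [coord_aff]
  refine (totalDegree_add _ _).trans (max_le ((totalDegree_add _ _).trans (max_le ?_ ?_)) (by simp)) <;>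
  · refine (totalDegree_mul _ _).trans ?_
    simp

theorem totalDegree_coord_aff_mul_le {M : Matrix (Fin 2) (Fin 2) k} (hM : M.det = 1) (v : Fin 2 → k)
    (g : SAut 2 k) (i : Fin 2) (h : (coord g 0).totalDegree ≤ (coord g 1).totalDegree) :
    (coord (aff M hM v * g) i).totalDegree ≤ (coord g 1).totalDegree := by
  rw [coord_mul, coord_aff]
  simp only [map_add, map_mul, aeval_X, aeval_C, algebraMap_eq]
  refine (totalDegree_add _ _).trans (max_le ((totalDegree_add _ _).trans (max_le ?_ ?_)) (by simp)) <;>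
  · refine (totalDegree_mul _ _).trans ?_
    simp [h]

/-- An affine map outside the triangular group has `M 0 1 ≠ 0`, so the dominant second component
moves into the first. -/
theorem totalDegree_coord_aff_mul {M : Matrix (Fin 2) (Fin 2) k} (hM : M.det = 1) (v : Fin 2 → k)
    (h01 : M 0 1 ≠ 0) (g : SAut 2 k) (h : (coord g 0).totalDegree < (coord g 1).totalDegree) :
    (coord (aff M hM v * g) 0).totalDegree = (coord g 1).totalDegree := by
  rw [coord_mul, coord_aff]
  simp only [map_add, map_mul, aeval_X, aeval_C, algebraMap_eq]
  have hg : coord g 1 ≠ 0 := by intro h0; rw [h0] at h; simp at h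
  have h1 : (C (M 0 1) * coord g 1).totalDegree = (coord g 1).totalDegree := by
    rw [totalDegree_mul_of_isDomain (by simpa using h01) hg, totalDegree_C, zero_add]
  have h2 : (C (M 0 0) * coord g 0).totalDegree < (C (M 0 1) * coord g 1).totalDegree := by
    rw [h1]
    refine ((totalDegree_mul _ _).trans ?_).trans_lt h
    simp
  have h3 := totalDegree_add_eq_right_of_totalDegree_lt h2
  rw [totalDegree_add_eq_left_of_totalDegree_lt, h3, h1]
  rw [h3, h1, totalDegree_C]
  omega

theorem one_le_totalDegree_coord_aff {M : Matrix (Fin 2) (Fin 2) k} (hM : M.det = 1) (v : Fin 2 → k)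
    (h01 : M 0 1 ≠ 0) : 1 ≤ (coord (aff M hM v) 0).totalDegree := by
  rw [coord_aff]
  have h : (C (M 0 0) * X 0 + C (M 0 1) * X 1 + C (v 0) : MvPolynomial (Fin 2) k).coeff
      (Finsupp.single 1 1) = M 0 1 := by
    rw [coeff_add, coeff_add, coeff_C_mul, coeff_C_mul, coeff_C, if_neg, coeff_X, coeff_X,
        if_pos rfl, if_neg]
    · simp
    · intro h; have := DFunLike.congr_fun h 0; simp at this
    · intro h; have := DFunLike.congr_fun h 1; simp at this
  have := le_totalDegree (mem_support_iff.2 (by rw [h]; exact h01))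
  simpa using this

/-- A triangular map that is not affine has `s` of degree at least `2`, so `s` of the first
component dominates the second. -/
theorem totalDegree_coord_tri_mul {f : SAut 2 k} (hf : f ∈ triSubgroup k) (hfA : f ∉ affSubgroup k)
    (g : SAut 2 k) (h0 : 1 ≤ (coord g 0).totalDegree)
    (h1 : (coord g 1).totalDegree ≤ (coord g 0).totalDegree) :
    (coord (f * g) 0).totalDegree = (coord g 0).totalDegree ∧
      (coord g 0).totalDegree < (coord (f * g) 1).totalDegree := by
  obtain ⟨a, b, s, ha, hf⟩ := hf
  have e0 : coord f 0 = C a * X 0 + C b := by rw [coord, hf]; rfl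
  have e1 : coord f 1 = C a⁻¹ * X 1 + Polynomial.aeval (X 0) s := by rw [coord, hf]; rfl
  have hs : 1 < s.natDegree := by
    by_contra hs
    apply hfA
    refine mem_affSubgroup_of_totalDegree_le fun i => ?_
    fin_cases i
    · change (coord f 0).totalDegree ≤ 1
      rw [e0]
      refine (totalDegree_add _ _).trans (max_le ?_ (by simp))
      refine (totalDegree_mul _ _).trans ?_
      simp
    · change (coord f 1).totalDegree ≤ 1
      rw [e1]
      refine (totalDegree_add _ _).trans (max_le ?_ ?_)
      · refine (totalDegree_mul _ _).trans ?_
        simp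
      · refine (totalDegree_aeval_le _ _).trans ?_
        rw [totalDegree_X]; omega
  have hg0 : coord g 0 ≠ 0 := by intro h; rw [h] at h0; simp at h0
  have hC (c : k) (hc : c ≠ 0) (p : MvPolynomial (Fin 2) k) : (C c * p).totalDegree = p.totalDegree := by
    rcases eq_or_ne p 0 with rfl | hp
    · simp
    · rw [totalDegree_mul_of_isDomain (by simpa using hc) hp, totalDegree_C, zero_add]
  rw [coord_mul, coord_mul, e0, e1]
  simp only [map_add, map_mul, aeval_X, aeval_C, algebraMap_eq, ← Polynomial.aeval_algHom_apply]
  constructor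
  · rw [totalDegree_add_eq_left_of_totalDegree_lt, hC a ha]
    rw [hC a ha, totalDegree_C]; omega
  · have h2 := totalDegree_aeval (coord g 0) (by omega) s
    have h3 : 2 * (coord g 0).totalDegree ≤ s.natDegree * (coord g 0).totalDegree :=
      Nat.mul_le_mul_right _ hs
    rw [totalDegree_add_eq_right_of_totalDegree_lt, h2]
    · omega
    · rw [hC _ (inv_ne_zero ha), h2]; omega

section Amalgam

open Monoid

variable (k) in
/-- The two factors of the amalgam. -/
def factor (i : Bool) : Subgroup (SAut 2 k) := if i then affSubgroup k else triSubgroup k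

variable (k) in
/-- The inclusion of the amalgamated subgroup into a factor. -/
noncomputable def factorMap (i : Bool) : ↥(affSubgroup k ⊓ triSubgroup k) →* ↥(factor k i) :=
  Subgroup.inclusion (by cases i; exacts [inf_le_right, inf_le_left])

variable (k) in
/-- The homomorphism from the amalgam. -/
noncomputable def fromAmalgam : PushoutI (factorMap k) →* SAut 2 k :=
  PushoutI.lift (fun i => (factor k i).subtype) (affSubgroup k ⊓ triSubgroup k).subtype
    fun _ => MonoidHom.ext fun _ => rfl

theorem fromAmalgam_of (i : Bool) (g : factor k i) :
    fromAmalgam k (PushoutI.of i g) = g.val :=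
  PushoutI.lift_of (φ := factorMap k) (fun i => (factor k i).subtype) _ _ (i := i) g

theorem fromAmalgam_base (h : ↥(affSubgroup k ⊓ triSubgroup k)) :
    fromAmalgam k (PushoutI.base (factorMap k) h) = h.val :=
  PushoutI.lift_base (φ := factorMap k) (fun i => (factor k i).subtype) _ _ h

theorem mem_range_factorMap {i : Bool} {g : factor k i} :
    g ∈ (factorMap k i).range ↔ g.val ∈ affSubgroup k ⊓ triSubgroup k := by
  constructor
  · rintro ⟨h, rfl⟩; exact h.property
  · intro h; exact ⟨⟨g.val, h⟩, rfl⟩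

/-- The condition satisfied by the product of a reduced word that begins in the given factor. -/
def ReducedShape (i : Option Bool) (x : PushoutI (factorMap k)) : Prop :=
  (i = none ∧ x = 1) ∨
  (i = some true ∧ 1 ≤ (coord (fromAmalgam k x) 0).totalDegree ∧
    (coord (fromAmalgam k x) 1).totalDegree ≤ (coord (fromAmalgam k x) 0).totalDegree ∧
    (1 < (coord (fromAmalgam k x) 0).totalDegree ∨ fromAmalgam k x ∉ triSubgroup k)) ∨
  (i = some false ∧ 1 ≤ (coord (fromAmalgam k x) 0).totalDegree ∧
    (coord (fromAmalgam k x) 0).totalDegree < (coord (fromAmalgam k x) 1).totalDegree)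

/-- Ping-pong on degrees: a triangular letter makes the second component strictly dominant, an
affine letter brings the dominant degree back to the first. A single affine letter has degree `1`
only, hence the clause on `triSubgroup` in the shape. -/
theorem ReducedShape.cons {i : Bool} {o : Option Bool} {x : PushoutI (factorMap k)}
    (hx : ReducedShape o x) (g : factor k i) (ho : o ≠ some i) (hg : g ∉ (factorMap k i).range) :
    ReducedShape (some i) (PushoutI.of i g * x) := by
  rw [mem_range_factorMap] at hg
  have he : fromAmalgam k (PushoutI.of i g * x) = g.val * fromAmalgam k x := by
    rw [map_mul, fromAmalgam_of]
  have hone : fromAmalgam k 1 = 1 := map_one _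
  cases i
  · have hgB : g.val ∈ triSubgroup k := g.property
    have hgA : g.val ∉ affSubgroup k := fun h => hg ⟨h, hgB⟩
    right; right
    rw [he]
    obtain ⟨h0, h1⟩ : 1 ≤ (coord (fromAmalgam k x) 0).totalDegree ∧
        (coord (fromAmalgam k x) 1).totalDegree ≤ (coord (fromAmalgam k x) 0).totalDegree := by
      rcases hx with ⟨-, rfl⟩ | ⟨-, h0, h1, -⟩ | ⟨rfl, -⟩
      · rw [hone, coord_one, coord_one, totalDegree_X, totalDegree_X]; exact ⟨le_rfl, le_rfl⟩
      · exact ⟨h0, h1⟩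
      · exact absurd rfl ho
    obtain ⟨h2, h3⟩ := totalDegree_coord_tri_mul hgB hgA _ h0 h1
    exact ⟨rfl, by omega, by omega⟩
  · have hgA : g.val ∈ affSubgroup k := g.property
    have hgB : g.val ∉ triSubgroup k := fun h => hg ⟨hgA, h⟩
    right; left
    rw [he]
    obtain ⟨M, hM, v, hMv⟩ := hgA
    rw [hMv] at hgB ⊢
    have h01 : M 0 1 ≠ 0 := fun h => hgB (aff_mem_triSubgroup hM h)
    refine ⟨rfl, ?_⟩
    rcases hx with ⟨-, rfl⟩ | ⟨rfl, -⟩ | ⟨-, h0, h1⟩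
    · rw [hone, mul_one]
      have h2 := one_le_totalDegree_coord_aff hM v h01
      exact ⟨h2, (totalDegree_coord_le_of_mem_affSubgroup ⟨_, _, _, rfl⟩ 1).trans h2, Or.inr hgB⟩
    · exact absurd rfl ho
    · have h2 := totalDegree_coord_aff_mul hM v h01 _ h1
      have h3 := totalDegree_coord_aff_mul_le hM v (fromAmalgam k x) 1 h1.le
      exact ⟨by omega, by omega, Or.inl (by omega)⟩

theorem ReducedShape.eq_one {o : Option Bool} {x : PushoutI (factorMap k)} (hx : ReducedShape o x)
    (h : fromAmalgam k x ∈ affSubgroup k ⊓ triSubgroup k) : x = 1 := by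
  have h0 := totalDegree_coord_le_of_mem_affSubgroup h.1 0
  have h1 := totalDegree_coord_le_of_mem_affSubgroup h.1 1
  rcases hx with ⟨-, h2⟩ | ⟨-, h2, h3, h4⟩ | ⟨-, h2, h3⟩
  · exact h2
  · rcases h4 with h4 | h4
    · omega
    · exact absurd h.2 h4
  · omega

/-- A normal form is a base element times a reduced word. If the product is trivial, the reduced
word maps into the amalgamated subgroup, which its shape allows only for the empty word. -/
theorem fromAmalgam_injective : Function.Injective (fromAmalgam k) := by
  classical
  have hinj : ∀ i, Function.Injective (factorMap k i) := fun i => Subgroup.inclusion_injective _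
  obtain ⟨d⟩ := PushoutI.NormalWord.transversal_nonempty (factorMap k) hinj
  -- The clause on `w.head` lets the induction drop the base element before a new letter is
  -- prepended.
  have key (w : PushoutI.NormalWord d) : ∃ h y, w.prod = PushoutI.base (factorMap k) h * y ∧
      (w.head = 1 → h = 1) ∧ ReducedShape w.fstIdx y := by
    induction w using PushoutI.NormalWord.consRecOn with
    | empty => exact ⟨1, 1, by simp, fun _ => rfl, Or.inl ⟨rfl, rfl⟩⟩
    | cons i g w hmw hgn hgr hw1 ih =>
      obtain ⟨h, y, hy, hh, hs⟩ := ih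
      rw [hh hw1, map_one, one_mul] at hy
      refine ⟨1, PushoutI.of i g * y, ?_, fun _ => rfl, ?_⟩
      · rw [PushoutI.NormalWord.prod_cons, hy, map_one, one_mul]
      · exact hs.cons g hmw hgr
    | base h w hw ih =>
      obtain ⟨h', y, hy, hh, hs⟩ := ih
      rw [hh hw, map_one, one_mul] at hy
      rw [PushoutI.NormalWord.base_smul_eq_smul]
      refine ⟨h, y, by rw [PushoutI.NormalWord.prod_base_smul, hy], fun h1 => ?_, hs⟩
      have : (h • w).head = h * w.head := rfl
      rwa [this, hw, mul_one] at h1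
  rw [injective_iff_map_eq_one]
  intro x hx
  obtain ⟨h, y, hy, -, hs⟩ := key (PushoutI.NormalWord.equiv (d := d) x)
  have hxy : x = PushoutI.base (factorMap k) h * y := by
    rw [← hy]; exact (PushoutI.NormalWord.equiv.symm_apply_apply x).symm
  have h1 : fromAmalgam k y = h.val⁻¹ := by
    rw [hxy, map_mul, fromAmalgam_base] at hx
    exact eq_inv_of_mul_eq_one_right hx
  have h2 := hs.eq_one (by rw [h1]; exact inv_mem h.property)
  rw [h2, map_one] at h1
  have h3 : h = 1 := Subtype.ext (inv_eq_one.1 h1.symm)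
  rw [hxy, h2, h3, map_one, mul_one]

theorem fromAmalgam_surjective : Function.Surjective (fromAmalgam k) := by
  rw [← MonoidHom.range_eq_top]
  have hmem (i : Bool) (g : factor k i) : g.val ∈ (fromAmalgam k).range :=
    ⟨PushoutI.of i g, fromAmalgam_of i g⟩
  refine eq_top_of_affSubgroup_le (fun f hf => hmem true ⟨f, hf⟩) fun s => ?_
  exact hmem false ⟨_, shear_mem_triSubgroup s⟩

/-- The group is the amalgamated product of the affine and the triangular subgroup. -/
theorem exists_monoidHom {M : Type*} [Monoid M] (α : affSubgroup k →* M) (β : triSubgroup k →* M)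
    (h : ∀ f hA hB, α ⟨f, hA⟩ = β ⟨f, hB⟩) :
    ∃ ρ : SAut 2 k →* M, (∀ f : affSubgroup k, ρ f = α f) ∧ ∀ f : triSubgroup k, ρ f = β f := by
  let e : PushoutI (factorMap k) ≃* SAut 2 k :=
    MulEquiv.ofBijective (fromAmalgam k) ⟨fromAmalgam_injective, fromAmalgam_surjective⟩
  let γ : (i : Bool) → factor k i →* M
    | true => α
    | false => β
  let δ : PushoutI (factorMap k) →* M := PushoutI.lift γ (α.comp (Subgroup.inclusion inf_le_left))
    fun i => by
      cases i
      · ext f; exact (h f.val f.2.1 f.2.2).symm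
      · rfl
  have he (i : Bool) (g : factor k i) : e.symm g.val = PushoutI.of i g := by
    rw [MulEquiv.symm_apply_eq]
    exact (fromAmalgam_of i g).symm
  refine ⟨δ.comp e.symm.toMonoidHom, fun f => ?_, fun f => ?_⟩
  · have := he true f
    change δ (e.symm f.val) = _
    rw [this]
    exact PushoutI.lift_of γ _ _ (i := true) f
  · have := he false f
    change δ (e.symm f.val) = _
    rw [this]
    exact PushoutI.lift_of γ _ _ (i := false) f

end Amalgam

end SAut

end

/-! ### The subspace `V` and the quotient `k[x]/V` -/

section

namespace Polynomial

variable {k : Type*} [Field k]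

theorem sub_comp_mem_spaceV (s : k[X]) {a : k} (ha : a ≠ 0) (b : k) :
    s - C a * s.comp (C a * X + C b) ∈ spaceV k :=
  Submodule.subset_span ⟨s, a, b, ha, rfl⟩

theorem C_mem_spaceV (c : k) : C c ∈ spaceV k := by
  have := sub_comp_mem_spaceV (X : k[X]) one_ne_zero (-c)
  simpa using this

theorem X_pow_mem_spaceV {n : ℕ} {a : k} (ha : a ≠ 0) (han : a ^ (n + 1) ≠ 1) :
    X ^ n ∈ spaceV k := by
  have h := sub_comp_mem_spaceV (X ^ n : k[X]) ha 0
  have e : (X ^ n : k[X]) - C a * (X ^ n : k[X]).comp (C a * X + C 0) = (1 - a ^ (n + 1)) • X ^ n := by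
    rw [smul_eq_C_mul]
    simp only [pow_comp, X_comp, map_zero, add_zero, mul_pow, map_sub, map_one, map_pow]
    ring
  rw [e] at h
  exact (Submodule.smul_mem_iff _ (sub_ne_zero.2 han.symm)).1 h

theorem mem_of_forall_X_pow_mem {S : Submodule k k[X]} (h : ∀ n, X ^ n ∈ S) (p : k[X]) : p ∈ S := by
  rw [p.as_sum_range_C_mul_X_pow]
  refine S.sum_mem fun i _ => ?_
  rw [← smul_eq_C_mul]
  exact S.smul_mem _ (h i)

theorem spaceV_eq_top [Infinite k] : spaceV k = ⊤ := by
  refine (Submodule.eq_top_iff').2 (mem_of_forall_X_pow_mem fun n => ?_)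
  classical
  obtain ⟨a, ha⟩ := Infinite.exists_notMem_finset (insert (0 : k) (nthRoots (n + 1) (1 : k)).toFinset)
  rw [Finset.mem_insert, Multiset.mem_toFinset, mem_nthRoots (Nat.succ_pos n), not_or] at ha
  exact X_pow_mem_spaceV ha.1 ha.2

theorem X_mem_spaceV (h : 2 < ENat.card k) : (X : k[X]) ∈ spaceV k := by
  by_cases h2 : (2 : k) = 0
  · have hex : ∃ a : k, a ≠ 0 ∧ a ≠ 1 := by
      by_contra! hcon
      have hsub : (Set.univ : Set k) ⊆ {0, 1} := fun a _ => by
        by_cases ha : a = 0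
        · exact Or.inl ha
        · exact Or.inr (hcon a ha)
      have h3 := Set.encard_le_encard hsub
      rw [Set.encard_univ] at h3
      have h4 : ({0, 1} : Set k).encard ≤ 2 := by
        rw [Set.encard_pair zero_ne_one]
      exact absurd (h.trans_le (h3.trans h4)) (lt_irrefl _)
    obtain ⟨a, ha, ha1⟩ := hex
    have := X_pow_mem_spaceV (n := 1) ha (by
      intro h1
      apply ha1
      -- In characteristic two the only square root of `1` is `1`, so any `a ≠ 0, 1` serves in
      -- `X_pow_mem_spaceV`.
      have : (a - 1) ^ 2 = 0 := by linear_combination h1 - (a - 1) * h2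
      exact sub_eq_zero.1 (pow_eq_zero_iff two_ne_zero |>.1 this))
    rwa [pow_one] at this
  -- `x² - (x + 1)² = -2x - 1`, and constants are already in `V`.
  · have h1 := sub_comp_mem_spaceV (X ^ 2 : k[X]) one_ne_zero 1
    have e : (X ^ 2 : k[X]) - C 1 * (X ^ 2 : k[X]).comp (C 1 * X + C 1) + C 1 = (-2 : k) • X := by
      rw [smul_eq_C_mul]
      simp only [pow_comp, X_comp, map_one, map_neg, one_mul]
      rw [show (C 2 : k[X]) = 2 from rfl]
      ring
    have h3 := (spaceV k).add_mem h1 (C_mem_spaceV 1)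
    rw [e] at h3
    exact (Submodule.smul_mem_iff _ (neg_ne_zero.2 h2)).1 h3

theorem linear_mem_spaceV (h : 2 < ENat.card k) (c d : k) : C c * X + C d ∈ spaceV k := by
  refine (spaceV k).add_mem ?_ (C_mem_spaceV d)
  rw [← smul_eq_C_mul]
  exact (spaceV k).smul_mem _ (X_mem_spaceV h)

theorem eq_zero_or_eq_one_of_card_eq_two (h : Nat.card k = 2) (a : k) : a = 0 ∨ a = 1 := by
  have : Finite k := Nat.finite_of_card_ne_zero (by omega)
  by_contra! hcon
  have h3 : ({0, 1, a} : Set k).ncard = 3 := by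
    rw [Set.ncard_eq_three]
    exact ⟨0, 1, a, zero_ne_one, hcon.1.symm, hcon.2.symm, rfl⟩
  have h4 := Set.ncard_le_card ({0, 1, a} : Set k)
  omega

section Two

/-- Follows from `x² = x(x + 1) - x` by induction on the degree. -/
theorem exists_eq_add_X_mul (s : k[X]) :
    ∃ w₁ ∈ Algebra.adjoin k {(X * (X + 1) : k[X])}, ∃ w₂ ∈ Algebra.adjoin k {(X * (X + 1) : k[X])},
      s = w₁ + X * w₂ := by
  set W := Algebra.adjoin k {(X * (X + 1) : k[X])}
  have hz : (X * (X + 1) : k[X]) ∈ W := Algebra.subset_adjoin rfl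
  induction s using Polynomial.induction_on with
  | C a => exact ⟨C a, W.algebraMap_mem a, 0, W.zero_mem, by simp⟩
  | add p q hp hq =>
    obtain ⟨a, ha, b, hb, rfl⟩ := hp
    obtain ⟨c, hc, d, hd, rfl⟩ := hq
    exact ⟨a + c, W.add_mem ha hc, b + d, W.add_mem hb hd, by ring⟩
  | monomial n a h =>
    obtain ⟨w, hw, w', hw', h⟩ := h
    refine ⟨X * (X + 1) * w', W.mul_mem hz hw', w - w', W.sub_mem hw hw', ?_⟩
    rw [pow_succ, ← mul_assoc, h]; ring

theorem comp_X_add_one_of_mem_adjoin (h2 : (2 : k) = 0) {w : k[X]}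
    (hw : w ∈ Algebra.adjoin k {(X * (X + 1) : k[X])}) : w.comp (X + 1) = w := by
  have h2' : (2 : k[X]) = 0 := by rw [show (2 : k[X]) = C 2 from rfl, h2, map_zero]
  induction hw using Algebra.adjoin_induction with
  | mem x hx =>
    rw [Set.mem_singleton_iff] at hx
    subst hx
    simp only [mul_comp, X_comp, add_comp, one_comp]
    linear_combination (X + 1) * h2'
  | algebraMap r => exact C_comp
  | add x y _ _ hx hy => rw [add_comp, hx, hy]
  | mul x y _ _ hx hy => rw [mul_comp, hx, hy]

/-- The only nontrivial substitution is `x ↦ x + 1`, which fixes `x(x + 1)`. For `s = w₁ + x w₂`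
with `w₁, w₂` invariant, the generator of `V` is `-w₂`, and every invariant `w₂` occurs. -/
theorem spaceV_eq_adjoin (h : Nat.card k = 2) :
    spaceV k = Subalgebra.toSubmodule (Algebra.adjoin k {(X * (X + 1) : k[X])}) := by
  have h2 : (2 : k) = 0 := by
    rcases eq_zero_or_eq_one_of_card_eq_two h 2 with h0 | h1
    · exact h0
    · exact absurd (by linear_combination h1 : (1 : k) = 0) one_ne_zero
  set W := Algebra.adjoin k {(X * (X + 1) : k[X])} with hW
  apply le_antisymm
  · rw [spaceV, Submodule.span_le]
    rintro _ ⟨s, a, b, ha, rfl⟩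
    rw [(eq_zero_or_eq_one_of_card_eq_two h a).resolve_left ha, map_one, one_mul, one_mul]
    rcases eq_zero_or_eq_one_of_card_eq_two h b with rfl | rfl
    · simp
    · obtain ⟨w, hw, w', hw', rfl⟩ := exists_eq_add_X_mul s
      rw [map_one, add_comp, mul_comp, X_comp, comp_X_add_one_of_mem_adjoin h2 hw,
        comp_X_add_one_of_mem_adjoin h2 hw']
      convert! W.neg_mem hw' using 1
      ring
  · intro w hw
    have h1 := sub_comp_mem_spaceV (X * w) one_ne_zero 1
    rw [map_one, one_mul, one_mul, mul_comp, X_comp, comp_X_add_one_of_mem_adjoin h2 hw] at h1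
    have e : w = -(X * w - (X + 1) * w) := by ring
    rw [e]
    exact (spaceV k).neg_mem h1

theorem X_notMem_spaceV (h : Nat.card k = 2) : (X : k[X]) ∉ spaceV k := by
  have h2 : (2 : k) = 0 := by
    rcases eq_zero_or_eq_one_of_card_eq_two h 2 with h0 | h1
    · exact h0
    · exact absurd (by linear_combination h1 : (1 : k) = 0) one_ne_zero
  rw [spaceV_eq_adjoin h]
  intro hX
  have := comp_X_add_one_of_mem_adjoin h2 hX
  rw [X_comp] at this
  exact one_ne_zero (add_eq_left.1 this)

end Two

section Finite

variable (k) in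
/-- The sum of `a s(ax + b)` over the affine group of a finite field. -/
noncomputable def affineTrace [Fintype k] [DecidableEq k] : k[X] →ₗ[k] k[X] :=
  ∑ a : kˣ, ∑ b : k, (LinearMap.mulLeft k (C (a : k))).comp
    (aeval (C (a : k) * X + C b : k[X]) : k[X] →ₐ[k] k[X]).toLinearMap

theorem affineTrace_apply [Fintype k] [DecidableEq k] (s : k[X]) :
    affineTrace k s = ∑ a : kˣ, ∑ b : k, C (a : k) * s.comp (C (a : k) * X + C b) := by
  simp [affineTrace, LinearMap.sum_apply, comp, aeval_def]

/-- Precomposition with a fixed affine substitution only permutes the terms of the sum. -/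
theorem spaceV_le_ker_affineTrace [Fintype k] [DecidableEq k] : spaceV k ≤
    LinearMap.ker (affineTrace k) := by
  rw [spaceV, Submodule.span_le]
  rintro _ ⟨s, a₀, b₀, ha, rfl⟩
  rw [SetLike.mem_coe, LinearMap.mem_ker, map_sub, sub_eq_zero, affineTrace_apply, affineTrace_apply]
  let u := Units.mk0 a₀ ha
  rw [← Equiv.sum_comp (Equiv.mulRight u)]
  refine Finset.sum_congr rfl fun a _ => ?_
  let e : k ≃ k := (Units.mulLeft u).trans (Equiv.addRight b₀)
  rw [← Equiv.sum_comp e]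
  refine Finset.sum_congr rfl fun b _ => ?_
  have e1 : ((Equiv.mulRight u a : kˣ) : k) = a * a₀ := rfl
  have e2 : e b = a₀ * b + b₀ := rfl
  rw [e1, e2, mul_comp, C_comp, comp_assoc]
  simp only [add_comp, mul_comp, C_comp, X_comp, map_mul, map_add]
  rw [mul_assoc]
  congr 3
  ring

/-- Both sides have degree below `q`, and at every point of `k` the sum becomes `∑ b ^ (q - 1) = q -
1 = -1`. -/
theorem sum_linear_pow [Fintype k] (a : kˣ) :
    ∑ b : k, (C (a : k) * X + C b : k[X]) ^ (Fintype.card k - 1) = -1 := by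
  classical
  have hq : 2 ≤ Fintype.card k := Fintype.one_lt_card
  rw [← sub_eq_zero, sub_neg_eq_add]
  refine eq_zero_of_natDegree_lt_card_of_eval_eq_zero _ (f := (id : k → k)) Function.injective_id
    (fun c => ?_) ?_
  · simp only [id, eval_add, eval_finsetSum, eval_pow, eval_mul, eval_C, eval_X, eval_one]
    rw [← Equiv.sum_comp (Equiv.subRight ((a : k) * c))]
    have h (b : k) : ((a : k) * c + Equiv.subRight ((a : k) * c) b) ^ (Fintype.card k - 1) =
        if b = 0 then 0 else 1 := by
      rw [show (a : k) * c + Equiv.subRight ((a : k) * c) b = b by simp]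
      split_ifs with hb
      · rw [hb, zero_pow (by omega)]
      · exact FiniteField.pow_card_sub_one_eq_one b hb
    simp only [h]
    rw [Finset.sum_ite, Finset.sum_const_zero, zero_add, Finset.sum_const, nsmul_eq_mul, mul_one,
      Finset.filter_ne' Finset.univ 0, Finset.card_erase_of_mem (Finset.mem_univ _), Finset.card_univ,
      Nat.cast_sub (by omega), FiniteField.cast_card_eq_zero]
    simp
  · refine lt_of_le_of_lt (natDegree_add_le_of_degree_le (n := Fintype.card k - 1) ?_ (by simp))
        (by omega)
    refine natDegree_sum_le_of_forall_le _ _ fun b _ => ?_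
    refine natDegree_pow_le.trans ?_
    have : (C (a : k) * X + C b : k[X]).natDegree ≤ 1 := natDegree_linear_le
    nlinarith

/-- The substitution multiplies `x^q - x` by `a`, and the total factor `a ^ (j + 1)` is `1` by the
condition on `j`. Each of the `q - 1` units then contributes `-(x^q - x)^j`, and `-(q - 1) = 1` in
`k`. -/
theorem affineTrace_mul_pow [Fintype k] [DecidableEq k] (j m : ℕ)
    (hj : j + 1 = m * (Fintype.card k - 1)) :
    affineTrace k (X ^ (Fintype.card k - 1) * (X ^ Fintype.card k - X) ^ j) =
      (X ^ Fintype.card k - X) ^ j := by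
  have hq : 2 ≤ Fintype.card k := Fintype.one_lt_card
  rw [affineTrace_apply]
  have hz (a : kˣ) (b : k) : (X ^ Fintype.card k - X : k[X]).comp (C (a : k) * X + C b) =
      C (a : k) * (X ^ Fintype.card k - X) := by
    rw [sub_comp, X_pow_comp, X_comp, ← FiniteField.expand_card]
    simp
    ring
  have h (a : kˣ) : ∑ b : k, C (a : k) *
      (X ^ (Fintype.card k - 1) * (X ^ Fintype.card k - X) ^ j).comp (C (a : k) * X + C b) =
      -(X ^ Fintype.card k - X) ^ j := by
    simp only [mul_comp, pow_comp, hz, X_comp]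
    have e : (a : k) ^ (j + 1) = 1 := by
      rw [hj, mul_comm, pow_mul, FiniteField.pow_card_sub_one_eq_one _ a.ne_zero, one_pow]
    calc _ = ∑ b : k, (C ((a : k) ^ (j + 1)) * (X ^ Fintype.card k - X) ^ j) *
            (C (a : k) * X + C b : k[X]) ^ (Fintype.card k - 1) :=
          Finset.sum_congr rfl fun b _ => by rw [map_pow, mul_pow, pow_succ]; ring
      _ = _ := by rw [← Finset.mul_sum, sum_linear_pow, e, map_one, one_mul, mul_neg_one]
  simp only [h]
  rw [Finset.sum_const, Finset.card_univ, Fintype.card_units, nsmul_eq_mul, Nat.cast_sub (by omega)]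
  have : ((Fintype.card k : ℕ) : k[X]) = 0 := by
    rw [← map_natCast C, FiniteField.cast_card_eq_zero, map_zero]
  rw [this]
  simp

variable (k) in
/-- The classes whose independence shows that `k[x]/V` is infinite-dimensional. -/
noncomputable def traceClass (m : {m : ℕ // 1 ≤ m}) : k[X] ⧸ spaceV k :=
  (spaceV k).mkQ (X ^ (Nat.card k - 1) * (X ^ Nat.card k - X) ^ (m.val * (Nat.card k - 1) - 1))

theorem linearIndependent_traceClass [Finite k] : LinearIndependent k (traceClass k) := by
  classical
  have := Fintype.ofFinite k
  have hq : 2 ≤ Fintype.card k := Fintype.one_lt_card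
  set T := (spaceV k).liftQ (affineTrace k) spaceV_le_ker_affineTrace
  apply LinearIndependent.of_comp T
  have h1 (m : {m : ℕ // 1 ≤ m}) : (T ∘ traceClass k) m =
      (X ^ Fintype.card k - X) ^ (m.val * (Fintype.card k - 1) - 1) := by
    simp only [Function.comp, traceClass, T, Submodule.mkQ_apply, Submodule.liftQ_apply,
        Nat.card_eq_fintype_card]
    refine affineTrace_mul_pow _ m.val ?_
    have : 1 * 1 ≤ m.val * (Fintype.card k - 1) := Nat.mul_le_mul m.2 (by omega)
    omega
  have hdeg : (X ^ Fintype.card k - X : k[X]).natDegree = Fintype.card k :=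
    FiniteField.X_pow_card_sub_X_natDegree_eq k (by omega)
  -- A nonconstant polynomial is transcendental, so its powers are linearly independent.
  have htr : Transcendental k (X ^ Fintype.card k - X : k[X]) := by
    have h0 : (X ^ Fintype.card k - X : k[X]) ≠ 0 := by
      intro h; rw [h, natDegree_zero] at hdeg; omega
    have := (Polynomial.transcendental_X k).aeval (X ^ Fintype.card k - X : k[X])
      (by rw [hdeg]; omega) (mem_nonZeroDivisors_of_ne_zero (leadingCoeff_ne_zero.2 h0))
    rwa [aeval_X_left_apply] at this
  rw [transcendental_iff_injective] at htr
  have h2 : LinearIndependent k fun j : ℕ => (X ^ Fintype.card k - X : k[X]) ^ j := by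
    have := (Polynomial.basisMonomials k).linearIndependent.map'
      (aeval (X ^ Fintype.card k - X : k[X]) : k[X] →ₐ[k] k[X]).toLinearMap (LinearMap.ker_eq_bot.2 htr)
    convert! this using 1
    ext1 j
    simp
  have h3 := h2.comp (fun m : {m : ℕ // 1 ≤ m} => m.val * (Fintype.card k - 1) - 1) ?_
  · convert! h3 using 1
    ext1 m
    exact h1 m
  · intro m m' hm
    have i1 : 1 * 1 ≤ m.val * (Fintype.card k - 1) := Nat.mul_le_mul m.2 (by omega)
    have i2 : 1 * 1 ≤ m'.val * (Fintype.card k - 1) := Nat.mul_le_mul m'.2 (by omega)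
    simp only at hm
    have i3 : m.val * (Fintype.card k - 1) = m'.val * (Fintype.card k - 1) := by omega
    exact Subtype.ext (Nat.eq_of_mul_eq_mul_right (by omega) i3)

theorem not_finite_quotient_spaceV [Finite k] : ¬ Module.Finite k (k[X] ⧸ spaceV k) := by
  intro h
  have : Infinite {m : ℕ // 1 ≤ m} := (Set.infinite_of_injective_forall_mem (f := Nat.succ)
    Nat.succ_injective fun n => Nat.succ_pos n).to_subtype
  exact Module.Finite.not_linearIndependent_of_infinite _ (linearIndependent_traceClass (k := k))

theorem exists_linearMap_traceClass [Finite k] (t : {m : ℕ // 1 ≤ m} → k[X]) :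
    ∃ L : (k[X] ⧸ spaceV k) →ₗ[k] k[X], ∀ m, L (traceClass k m) = t m := by
  obtain ⟨g, hg⟩ := LinearMap.exists_leftInverse_of_injective
    (Finsupp.linearCombination k (traceClass k)) (LinearMap.ker_eq_bot.2 linearIndependent_traceClass)
  refine ⟨(Finsupp.linearCombination k t).comp g, fun m => ?_⟩
  have h := LinearMap.congr_fun hg (Finsupp.single m 1)
  simp only [LinearMap.comp_apply, Finsupp.linearCombination_single, one_smul, LinearMap.id_apply] at h
  rw [LinearMap.comp_apply, h, Finsupp.linearCombination_single, one_smul]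

theorem surjective_of_X_pow_mem_range {N : Type*} [AddCommGroup N] [Module k N] (L : N →ₗ[k] k[X])
    (h : ∀ n, X ^ n ∈ LinearMap.range L) : Function.Surjective L :=
  fun p => mem_of_forall_X_pow_mem h p

theorem traceClass_one_of_card_eq_two (h : Nat.card k = 2) :
    traceClass k ⟨1, le_rfl⟩ = (spaceV k).mkQ X := by
  simp [traceClass, h]

end Finite

end Polynomial

end

/-! ### Construction and uniqueness of `ρ` -/

section

variable {k : Type*} [Field k]

namespace SAut

/-- The coefficients of the linear part. -/
noncomputable def linCoeff (f : SAut 2 k) (i j : Fin 2) : k :=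
  coeff (Finsupp.single j 1) (coord f i)

/-- The polynomial `s` of a triangular automorphism `(a x₁ + b, a⁻¹ x₂ + s(x₁))`. -/
noncomputable def triPoly (f : SAut 2 k) : Polynomial k :=
  aeval ![Polynomial.X, 0] (coord f 1)

theorem linCoeff_aff (M : Matrix (Fin 2) (Fin 2) k) (hM : M.det = 1) (v : Fin 2 → k) (i j : Fin 2) :
    linCoeff (aff M hM v) i j = M i j := by
  have h01 : (Finsupp.single (0 : Fin 2) 1 : Fin 2 →₀ ℕ) ≠ Finsupp.single 1 1 := by
    intro h; have := DFunLike.congr_fun h 0; simp at this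
  have h0 (i : Fin 2) : (0 : Fin 2 →₀ ℕ) ≠ Finsupp.single i 1 := by
    intro h; have := DFunLike.congr_fun h i; simp at this
  rw [linCoeff, coord_aff, coeff_add, coeff_add, coeff_C_mul, coeff_C_mul, coeff_C, if_neg (h0 j),
    coeff_X, coeff_X]
  fin_cases j <;> simp [h01, h01.symm]

theorem triPoly_aff (M : Matrix (Fin 2) (Fin 2) k) (hM : M.det = 1) (v : Fin 2 → k) :
    triPoly (aff M hM v) = Polynomial.C (M 1 0) * Polynomial.X + Polynomial.C (v 1) := by
  simp [triPoly, coord_aff, Polynomial.algebraMap_eq]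

theorem linCoeff_of_eq_triEnd {f : SAut 2 k} {a b : k} {s : Polynomial k}
    (h : f.val.val = triEnd a b s) : linCoeff f 0 0 = a := by
  have e : coord f 0 = C a * X 0 + C b := by rw [coord, h]; rfl
  have h0 (i : Fin 2) : (0 : Fin 2 →₀ ℕ) ≠ Finsupp.single i 1 := by
    intro h; have := DFunLike.congr_fun h i; simp at this
  rw [linCoeff, e, coeff_add, coeff_C_mul, coeff_C, if_neg (h0 0), coeff_X, if_pos rfl, mul_one,
    add_zero]

theorem triPoly_of_eq_triEnd {f : SAut 2 k} {a b : k} {s : Polynomial k}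
    (h : f.val.val = triEnd a b s) : triPoly f = s := by
  have e : coord f 1 = C a⁻¹ * X 1 + Polynomial.aeval (X 0) s := by rw [coord, h]; rfl
  rw [triPoly, e]
  simp [← Polynomial.aeval_algHom_apply]

variable (k) in
/-- The homomorphism to `k[x]/V` on the triangular subgroup. -/
noncomputable def triHom : triSubgroup k →* Multiplicative (Polynomial k ⧸ spaceV k) :=
  MonoidHom.mk' (fun f => Multiplicative.ofAdd
      ((spaceV k).mkQ (Polynomial.C (linCoeff f.val 0 0) * triPoly f.val))) fun f g => by
    obtain ⟨a, b, s, ha, hf⟩ := f.property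
    obtain ⟨a', b', s', ha', hg⟩ := g.property
    have hfg : (f.val * g.val).val.val = f.val.val.val * g.val.val.val := rfl
    rw [hf, hg, triEnd_mul] at hfg
    change Multiplicative.ofAdd ((spaceV k).mkQ (Polynomial.C (linCoeff (f.val * g.val) 0 0) *
      triPoly (f.val * g.val))) = _
    rw [linCoeff_of_eq_triEnd hf, linCoeff_of_eq_triEnd hg, linCoeff_of_eq_triEnd hfg,
      triPoly_of_eq_triEnd hf, triPoly_of_eq_triEnd hg, triPoly_of_eq_triEnd hfg, ← ofAdd_add,
      ← map_add]
    congr 1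
    rw [Submodule.mkQ_apply, Submodule.mkQ_apply, Submodule.Quotient.eq]
    -- The product has polynomial `a⁻¹ s' + s(a'x + b')`; multiplied by `a a'` it becomes `a' s' +
    -- a' (a s)(a'x + b')`, congruent to `a' s' + a s` modulo `V`.
    have h := (spaceV k).neg_mem (Polynomial.sub_comp_mem_spaceV (Polynomial.C a * s) ha' b')
    convert! h using 1
    have e : (Polynomial.C a * Polynomial.C a⁻¹ : Polynomial k) = 1 := by
      rw [← map_mul, mul_inv_cancel₀ ha, map_one]
    rw [Polynomial.mul_comp, Polynomial.C_comp, map_mul]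
    linear_combination (Polynomial.C a' * s') * e

theorem triHom_apply (f : triSubgroup k) : triHom k f = Multiplicative.ofAdd
    ((spaceV k).mkQ (Polynomial.C (linCoeff f.val 0 0) * triPoly f.val)) := rfl

/-- The sign character of `SL₂(𝔽₂)`, as a polynomial in the entries. -/
def signForm {R : Type*} [CommRing R] (a b c d : R) : R := (a + d + 1) * (b + c + b * c)

/-- The odd elements of `SL₂(𝔽₂) ≅ S₃` are the nonidentity matrices of trace `0`, and these are
where the form is `1`. -/
theorem signForm_mul_zmod : ∀ a b c d a' b' c' d' : ZMod 2, a * d - b * c = 1 →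
    a' * d' - b' * c' = 1 →
    signForm (a * a' + b * c') (a * b' + b * d') (c * a' + d * c') (c * b' + d * d') =
      signForm a b c d + signForm a' b' c' d' := by
  unfold signForm
  decide

theorem signForm_mul (h : Nat.card k = 2) {a b c d a' b' c' d' : k} (h1 : a * d - b * c = 1)
    (h2 : a' * d' - b' * c' = 1) :
    signForm (a * a' + b * c') (a * b' + b * d') (c * a' + d * c') (c * b' + d * d') =
      signForm a b c d + signForm a' b' c' d' := by
  have : Finite k := Nat.finite_of_card_ne_zero (by omega)
  have := Fintype.ofFinite k
  let e : k ≃+* ZMod 2 := (ZMod.ringEquivOfPrime k Nat.prime_two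
    (by rw [← Nat.card_eq_fintype_card, h])).symm
  apply e.injective
  have := signForm_mul_zmod (e a) (e b) (e c) (e d) (e a') (e b') (e c') (e d')
    (by rw [← map_mul, ← map_mul, ← map_sub, h1, map_one])
    (by rw [← map_mul, ← map_mul, ← map_sub, h2, map_one])
  simp only [signForm, map_add, map_mul, map_one] at this ⊢
  exact this

/-- The homomorphism to `k[x]/V` on the affine subgroup over the field with two elements. -/
noncomputable def signHom (h : Nat.card k = 2) :
    affSubgroup k →* Multiplicative (Polynomial k ⧸ spaceV k) :=
  MonoidHom.mk' (fun f => Multiplicative.ofAdd ((spaceV k).mkQ (Polynomial.C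
      (signForm (linCoeff f.val 0 0) (linCoeff f.val 0 1) (linCoeff f.val 1 0) (linCoeff f.val 1 1)) *
        Polynomial.X))) fun f g => by
    obtain ⟨M, hM, v, hf⟩ := f.property
    obtain ⟨N, hN, w, hg⟩ := g.property
    have hfg : (f * g).val = f.val * g.val := rfl
    rw [hfg, hf, hg, aff_mul]
    simp only [linCoeff_aff, Matrix.mul_apply, Fin.sum_univ_two]
    rw [Matrix.det_fin_two] at hM hN
    rw [signForm_mul h hM hN, ← ofAdd_add, ← map_add, map_add, add_mul]

theorem exists_affHom [Finite k] : ∃ α : affSubgroup k →* Multiplicative (Polynomial k ⧸ spaceV k),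
    (∀ f hA hB, α ⟨f, hA⟩ = triHom k ⟨f, hB⟩) ∧
    (2 < ENat.card k → ∀ f, α f = 1) ∧
    ∀ f, ∃ c : k, α f = Multiplicative.ofAdd ((spaceV k).mkQ (Polynomial.C c * Polynomial.X)) := by
  have htri {M : Matrix (Fin 2) (Fin 2) k} (hM : M.det = 1) (v : Fin 2 → k)
      (hB : aff M hM v ∈ triSubgroup k) : M 0 1 = 0 := by
    obtain ⟨a, b, s, ha, h⟩ := hB
    have h1 := linCoeff_aff M hM v 0 1
    have e : coord (aff M hM v) 0 = C a * X 0 + C b := by rw [coord, h]; rfl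
    rw [← h1, linCoeff, e, coeff_add, coeff_C_mul, coeff_C, coeff_X, if_neg, if_neg, mul_zero,
      add_zero]
    · intro h; have := DFunLike.congr_fun h 1; simp at this
    · intro h; have := DFunLike.congr_fun h 1; simp at this
  by_cases hk : 2 < ENat.card k
  · refine ⟨1, ?_, fun _ _ => rfl, fun f => ⟨0, by simp⟩⟩
    rintro f ⟨M, hM, v, rfl⟩ hB
    rw [triHom_apply, MonoidHom.one_apply, ← ofAdd_zero]
    congr 1
    symm
    rw [Submodule.mkQ_apply, Submodule.Quotient.mk_eq_zero, triPoly_aff, ← Polynomial.smul_eq_C_mul]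
    exact (spaceV k).smul_mem _ (Polynomial.linear_mem_spaceV hk _ _)
  · have h2 : Nat.card k = 2 := by
      have h1 : 1 < Nat.card k := Finite.one_lt_card
      rw [ENat.card_eq_coe_natCard] at hk
      have : ¬ 2 < Nat.card k := fun h => hk (by exact_mod_cast h)
      omega
    refine ⟨signHom h2, ?_, fun h => absurd h hk, fun f => ⟨_, rfl⟩⟩
    rintro f ⟨M, hM, v, rfl⟩ hB
    have h01 := htri hM v hB
    have two : (2 : k) = 0 := by
      rcases Polynomial.eq_zero_or_eq_one_of_card_eq_two h2 2 with h0 | h1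
      · exact h0
      · exact absurd (by linear_combination h1 : (1 : k) = 0) one_ne_zero
    have hd : M 0 0 * M 1 1 = 1 := by rw [Matrix.det_fin_two, h01] at hM; simpa using hM
    have h00 : M 0 0 = 1 :=
      (Polynomial.eq_zero_or_eq_one_of_card_eq_two h2 _).resolve_left (left_ne_zero_of_mul_eq_one hd)
    have h11 : M 1 1 = 1 :=
      (Polynomial.eq_zero_or_eq_one_of_card_eq_two h2 _).resolve_left (right_ne_zero_of_mul_eq_one hd)
    rw [triHom_apply]
    change Multiplicative.ofAdd ((spaceV k).mkQ _) = _
    congr 1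
    simp only [linCoeff_aff, triPoly_aff, h01, h00, h11, signForm]
    rw [Submodule.mkQ_apply, Submodule.mkQ_apply, Submodule.Quotient.eq]
    -- On a lower unipotent matrix the sign is its lower left entry, so both homomorphisms give the
    -- class of `M 1 0 * x`; the constant `v 1` lies in `V`.
    have h3 : ((1 : k) + 1 + 1) * (0 + M 1 0 + 0 * M 1 0) = M 1 0 := by
      linear_combination (M 1 0) * two
    rw [h3, map_one, one_mul, sub_add_cancel_left, ← map_neg]
    exact Polynomial.C_mem_spaceV _

variable (k) in
theorem exists_rho [Finite k] : ∃ ρ : SAut 2 k →* Multiplicative (Polynomial k ⧸ spaceV k),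
    (∀ s : Polynomial k, ρ (shear s) = Multiplicative.ofAdd ((spaceV k).mkQ s)) ∧
    (∀ f ∈ translationSet 2 k, ρ f = 1) ∧
    (2 < ENat.card k → ∀ f ∈ affSubgroup k, ρ f = 1) ∧
    ∀ f ∈ affSubgroup k, ∃ c : k,
      ρ f = Multiplicative.ofAdd ((spaceV k).mkQ (Polynomial.C c * Polynomial.X)) := by
  obtain ⟨α, hα, hα1, hα2⟩ := exists_affHom (k := k)
  obtain ⟨ρ, hρA, hρB⟩ := exists_monoidHom α (triHom k) hα
  refine ⟨ρ, fun s => ?_, fun f hf => ?_, fun hk f hf => ?_, fun f hf => ?_⟩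
  · have h : (shear s).val.val = triEnd 1 0 s := by
      refine AffineEnd.ext (funext fun i => ?_)
      fin_cases i <;> simp [shear, shearAut, triEnd]
    rw [hρB ⟨shear s, shear_mem_triSubgroup s⟩, triHom_apply, linCoeff_of_eq_triEnd h,
      triPoly_of_eq_triEnd h, map_one, one_mul]
  · obtain ⟨v, rfl⟩ := exists_eq_aff_of_mem_translationSet hf
    rw [hρB ⟨_, aff_mem_triSubgroup _ (by simp)⟩, triHom_apply, ← ofAdd_zero]
    congr 1
    simp only [linCoeff_aff, triPoly_aff]
    rw [Submodule.mkQ_apply, Submodule.Quotient.mk_eq_zero]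
    simpa using Polynomial.C_mem_spaceV (v 1)
  · rw [hρA ⟨f, hf⟩, hα1 hk]
  · rw [hρA ⟨f, hf⟩]; exact hα2 _

/-- A homomorphism to an abelian group is determined by the shears. -/
theorem monoidHom_ext {A : Type*} [CommGroup A] {ρ ρ' : SAut 2 k →* A}
    (h : ∀ s, ρ (shear s) = ρ' (shear s)) : ρ = ρ' := by
  -- Conjugate elements have the same image in an abelian group.
  have hl (φ : SAut 2 k →* A) (s : Polynomial k) : φ (lowerShear s) = φ (shear s) := by
    rw [lowerShear, map_mul, map_mul, map_inv, mul_comm, mul_inv_cancel_left]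
  have : MonoidHom.eqLocus ρ ρ' = ⊤ := eq_top_of_shear_mem h fun s => by
    change ρ _ = ρ' _
    rw [hl, hl, h]
  ext f
  have hf : f ∈ MonoidHom.eqLocus ρ ρ' := by rw [this]; trivial
  exact hf

theorem mem_affSubgroup_of_mem_slSet {f : SAut 2 k} (h : f ∈ slSet 2 k) : f ∈ affSubgroup k := by
  obtain ⟨M, hM, rfl⟩ := exists_eq_aff_of_mem_slSet h
  exact ⟨M, hM, 0, rfl⟩

theorem shear_X_mem_slSet : shear (Polynomial.X : Polynomial k) ∈ slSet 2 k := by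
  have e : shear (Polynomial.X : Polynomial k) =
      aff !![1, 0; 1, 1] (by simp [Matrix.det_fin_two]) 0 := ext_coord fun i => by
    fin_cases i <;> simp [coord_aff, coord_shear_zero, coord_shear_one, add_comm]
  rw [e]
  exact aff_mem_slSet _ _

theorem normalClosure_saffSet_le {G : Type*} [Group G] (τ : SAut 2 k →* G)
    (h1 : translationSet 2 k ⊆ τ.ker) (h2 : slSet 2 k ⊆ τ.ker) :
    Subgroup.normalClosure (saffSet 2 k) ≤ τ.ker := by
  refine Subgroup.normalClosure_le_normal fun f hf => ?_
  obtain ⟨M, hM, v, rfl⟩ := exists_eq_aff_of_mem_saffSet hf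
  rw [aff_eq_translation_mul_linear]
  exact τ.ker.mul_mem (h1 (aff_mem_translationSet v)) (h2 (aff_mem_slSet M hM))

theorem ker_ne_top_of_surjective {G H : Type*} [Group G] [Group H] [Nontrivial H] (τ : G →* H)
    (h : Function.Surjective τ) : τ.ker ≠ ⊤ := by
  intro ht
  obtain ⟨x, hx⟩ := exists_ne (1 : H)
  obtain ⟨g, rfl⟩ := h x
  have : g ∈ τ.ker := by rw [ht]; trivial
  exact hx this

/-- Generators of `M` as an abelian group also span it over `k`. -/
theorem not_fg_of_surjective {G M : Type*} [Group G] [AddCommGroup M] [Module k M]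
    (τ : G →* Multiplicative M) (h : Function.Surjective τ) (hM : ¬ Module.Finite k M) :
    ¬ Group.FG G := by
  intro hG
  have h1 : Group.FG (Multiplicative M) := Group.fg_of_surjective h
  have h2 : AddGroup.FG M := AddGroup.fg_iff_mul_fg.2 h1
  have h3 : Module.Finite ℤ M := Module.Finite.iff_addGroup_fg.2 h2
  exact hM (Module.Finite.of_restrictScalars_finite ℤ k M)

end SAut

end

/-! ### Assembly of the main theorem -/

open SAut

theorem mainTheorem6 (k : Type*) [Field k] :
    -- the subspace `V` of `k[x]`, for an arbitrary field `k`
    ((∀ c : k, Polynomial.C c ∈ spaceV k) ∧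
      (Infinite k → spaceV k = ⊤) ∧
      (Finite k →
        LinearIndependent k (fun m : {m : ℕ // 1 ≤ m} =>
          (spaceV k).mkQ (Polynomial.X ^ (Nat.card k - 1) *
            (Polynomial.X ^ Nat.card k - Polynomial.X) ^ (m.val * (Nat.card k - 1) - 1))) ∧
        ¬ Module.Finite k (Polynomial k ⧸ spaceV k)) ∧
      (2 < ENat.card k →
        ∀ c d : k, Polynomial.C c * Polynomial.X + Polynomial.C d ∈ spaceV k) ∧
      (Nat.card k = 2 →
        spaceV k = Subalgebra.toSubmodule
          (Algebra.adjoin k {(Polynomial.X * (Polynomial.X + 1) : Polynomial k)}) ∧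
        Polynomial.X ∉ spaceV k)) ∧
    (Finite k →
      (∃ ρ : SAut 2 k →* Multiplicative (Polynomial k ⧸ spaceV k),
        -- `ρ` sends `(x_1, x_2 + s(x_1))` to the class of `s`; it is unique and surjective
        (∀ s : Polynomial k, ρ (shear s) = Multiplicative.ofAdd ((spaceV k).mkQ s)) ∧
        (∀ ρ' : SAut 2 k →* Multiplicative (Polynomial k ⧸ spaceV k),
          (∀ s : Polynomial k, ρ' (shear s) = Multiplicative.ofAdd ((spaceV k).mkQ s)) →
            ρ' = ρ) ∧
        Function.Surjective ρ ∧
        translationSet 2 k ⊆ ρ.ker ∧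
        (slSet 2 k ⊆ ρ.ker ↔ 2 < ENat.card k) ∧
        -- a surjection onto `(k[x], +)`, induced by `ρ`, killing translations and `SL_2(k)`
        (∃ (τ : SAut 2 k →* Multiplicative (Polynomial k))
            (L : (Polynomial k ⧸ spaceV k) →ₗ[k] Polynomial k),
          (∀ f, τ f = Multiplicative.ofAdd (L (ρ f).toAdd)) ∧
          Function.Surjective τ ∧
          translationSet 2 k ⊆ τ.ker ∧
          slSet 2 k ⊆ τ.ker) ∧
        -- over the field with two elements, another one that does not kill `SL_2(k)`
        (Nat.card k = 2 →
          ∃ (τ : SAut 2 k →* Multiplicative (Polynomial k))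
              (L : (Polynomial k ⧸ spaceV k) →ₗ[k] Polynomial k),
            (∀ f, τ f = Multiplicative.ofAdd (L (ρ f).toAdd)) ∧
            Function.Surjective τ ∧
            translationSet 2 k ⊆ τ.ker ∧
            ¬ slSet 2 k ⊆ τ.ker)) ∧
      -- `SAut_k(𝔸²)` is not perfect and not finitely generated
      commutator (SAut 2 k) ≠ ⊤ ∧
      ¬ Group.FG (SAut 2 k) ∧
      -- the normal closure of `SAff_k(𝔸²)` is a proper subgroup
      Subgroup.normalClosure (saffSet 2 k) ≠ ⊤) := by
  refine ⟨⟨Polynomial.C_mem_spaceV, fun _ => Polynomial.spaceV_eq_top,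
      fun _ => ⟨Polynomial.linearIndependent_traceClass,
    Polynomial.not_finite_quotient_spaceV⟩, Polynomial.linear_mem_spaceV,
        fun h => ⟨Polynomial.spaceV_eq_adjoin h,
    Polynomial.X_notMem_spaceV h⟩⟩, fun _ => ?_⟩
  obtain ⟨ρ, hs, ht, hA1, hA2⟩ := exists_rho k
  have hsurj : Function.Surjective ρ := fun y => by
    obtain ⟨s, hs'⟩ := (spaceV k).mkQ_surjective y.toAdd
    exact ⟨shear s, by rw [hs, hs', ofAdd_toAdd]⟩
  have hcard (h : ¬ 2 < ENat.card k) : Nat.card k = 2 := by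
    have h1 : 1 < Nat.card k := Finite.one_lt_card
    rw [ENat.card_eq_coe_natCard] at h
    have : ¬ 2 < Nat.card k := fun h' => h (by exact_mod_cast h')
    omega
  let comp (L : (Polynomial k ⧸ spaceV k) →ₗ[k] Polynomial k) :
      SAut 2 k →* Multiplicative (Polynomial k) :=
    (AddMonoidHom.toMultiplicative L.toAddMonoidHom).comp ρ
  have hcomp (L : (Polynomial k ⧸ spaceV k) →ₗ[k] Polynomial k) (f : SAut 2 k) :
      comp L f = Multiplicative.ofAdd (L (ρ f).toAdd) := rfl
  have hcs (L : (Polynomial k ⧸ spaceV k) →ₗ[k] Polynomial k) (hL : Function.Surjective L) :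
      Function.Surjective (comp L) := fun y => by
    obtain ⟨x, hx⟩ := hL y.toAdd
    obtain ⟨f, hf⟩ := hsurj (Multiplicative.ofAdd x)
    exact ⟨f, by rw [hcomp, hf, toAdd_ofAdd, hx, ofAdd_toAdd]⟩
  have hct (L : (Polynomial k ⧸ spaceV k) →ₗ[k] Polynomial k) :
      translationSet 2 k ⊆ (comp L).ker := fun f hf => by
    rw [SetLike.mem_coe, MonoidHom.mem_ker, hcomp, ht f hf, toAdd_one, map_zero, ofAdd_zero]
  -- For `q = 2` the class with `m = 1` is that of `x`, which spans the image of `SL₂`; `L₁` kills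
  -- it and shifts the others onto the powers of `x`.
  obtain ⟨L₁, hL₁⟩ := Polynomial.exists_linearMap_traceClass (k := k)
    fun m => if m.val = 1 then 0 else Polynomial.X ^ (m.val - 2)
  have hL₁s : Function.Surjective L₁ := Polynomial.surjective_of_X_pow_mem_range L₁ fun n =>
    ⟨Polynomial.traceClass k ⟨n + 2, by omega⟩, by rw [hL₁, if_neg (by simp)]; simp⟩
  have hL₁k : slSet 2 k ⊆ (comp L₁).ker := fun f hf => by
    have hfA := mem_affSubgroup_of_mem_slSet hf
    rw [SetLike.mem_coe, MonoidHom.mem_ker, hcomp]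
    by_cases hk : 2 < ENat.card k
    · rw [hA1 hk f hfA, toAdd_one, map_zero, ofAdd_zero]
    · obtain ⟨c, hc⟩ := hA2 f hfA
      rw [hc, toAdd_ofAdd, ← Polynomial.smul_eq_C_mul, map_smul, map_smul,
        ← Polynomial.traceClass_one_of_card_eq_two (hcard hk), hL₁, if_pos rfl, smul_zero, ofAdd_zero]
  refine ⟨⟨ρ, hs, fun ρ' h' => monoidHom_ext fun s => by rw [h', hs], hsurj, ht, ?_,
    ⟨comp L₁, L₁, hcomp L₁, hcs L₁ hL₁s, hct L₁, hL₁k⟩, fun h2 => ?_⟩, fun h => ?_,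
    not_fg_of_surjective ρ hsurj Polynomial.not_finite_quotient_spaceV, fun h => ?_⟩
  · refine ⟨fun h => ?_, fun hk f hf => hA1 hk f (mem_affSubgroup_of_mem_slSet hf)⟩
    by_contra hk
    have h1 : ρ (shear Polynomial.X) = 1 := h shear_X_mem_slSet
    rw [hs, ← ofAdd_zero] at h1
    exact Polynomial.X_notMem_spaceV (hcard hk)
        ((Submodule.Quotient.mk_eq_zero _).1 (Multiplicative.ofAdd.injective h1))
  -- `L₂` sends the class of `x` to `1`, so the shear by `x`, an element of `SL₂`, is not killed.
  · obtain ⟨L₂, hL₂⟩ := Polynomial.exists_linearMap_traceClass (k := k)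
        fun m => Polynomial.X ^ (m.val - 1)
    have hL₂s : Function.Surjective L₂ := Polynomial.surjective_of_X_pow_mem_range L₂ fun n =>
      ⟨Polynomial.traceClass k ⟨n + 1, by omega⟩, by rw [hL₂]; simp⟩
    refine ⟨comp L₂, L₂, hcomp L₂, hcs L₂ hL₂s, hct L₂, fun h => ?_⟩
    have h1 : comp L₂ (shear Polynomial.X) = 1 := h shear_X_mem_slSet
    rw [hcomp, hs, toAdd_ofAdd, ← Polynomial.traceClass_one_of_card_eq_two h2, hL₂, ← ofAdd_zero] at h1
    have h3 := Multiplicative.ofAdd.injective h1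
    simp at h3
  · have h1 := Abelianization.commutator_subset_ker (comp L₁)
    rw [h, top_le_iff] at h1
    exact ker_ne_top_of_surjective _ (hcs L₁ hL₁s) h1
  · have h1 := normalClosure_saffSet_le (comp L₁) (hct L₁) hL₁k
    rw [h, top_le_iff] at h1
    exact ker_ne_top_of_surjective _ (hcs L₁ hL₁s) h1
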